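/- Let $\mathbb{G}=(V,E)$ be a connected, locally finite, simple graph with graph distance $d_{\mathbb G}$, and let $d\ge 2$ be a real number. Assume that $\mathbb{G}$ has polynomial growth with exponent $d$: there is $C>1$ such that $C^{-1}r^d\le |\{y\in V: d_{\mathbb G}(x,y)<r\}|\le C r^d$ for all $x\in V$ and all real $r\ge 1$. Orient the edges arbitrarily. The cable system $\mathcal{X}$ of $\mathbb{G}$ is the quotient of $E\times[0,1]$ ($E$ discrete) in which the endpoints of edges that correspond to the same vertex are identified: $(e,0)$ corresponds to the source of $e$ and $(e,1)$ to its target. Let $d_1$ be the largest metric on $\mathcal{X}$ with $d_1((e,s),(e,t))\le|s-t|$ for all $e\in E$, $s,t\in[0,1]$, let $B(x,r)$ denote its open balls, and let $\mu_1$ be the Borel measure on $\mathcal X$ that is Lebesgue measure on each edge and gives no mass to the set of vertices. A function $f:\mathcal{X}\to\mathbb{R}$ is absolutely continuous if it is continuous and $s\mapsto f(e,s)$ is absolutely continuous on $[0,1]$ for every $e\in E$; then $|\nabla f|(e,s)=|\frac{d}{ds}f(e,s)|$ is defined $\mu_1$-almost everywhere, and we put $\mathcal{E}(f,f)=\int_{\mathcal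 X}|\nabla f|^2\,d\mu_1$. Let $\mathcal{F}$ be the closure, in the norm $f\mapsto(\mathcal{E}(f,f)+\|f\|^2_{L^2(\mu_1)})^{1/2}$, of the set of compactly supported absolutely continuous functions of finite energy, and for a nonempty open set $D$ let $\mathcal{F}_D$ be the closure in the same norm of the set of functions in $\mathcal{F}$ that are continuous with compact support in $D$; every element of these spaces is represented by its absolutely continuous version. Put $$\operatorname{Cap}_D(A)=\inf\{\mathcal{E}(f,f): f\in\mathcal{F}_D,\ f\ge 1\text{ in a neighbourhood of }A\}.$$ Assume that 1. (capacity upper bound) there are $C,M\ge1$ such that $\operatorname{Cap}_{B(x,Mr)}(B(x,r))\le C$ for all $x\in\mathcal{X}$ and $r\ge1$; 2. (Poincaré inequality $\mathrm{PI}(\Psi)$ with $\Psi(r)=r^2\vee r^d$) there are $C,M\ge1$ such that for all $f\in\mathcal{F}$, $x\in\mathcal{X}$ and $0<r<\operatorname{diam}(\mathcal{X})/2$, $$\int_{B(x,r)}|f-f_{B(x,r)}|^2\,d\mu_1\le C\,(r^2\vee r^d)\int_{B(x,Mr)}|\nabla f|^2\,d\mu_1,\qquad f_{B(x,r)}=\frac{1}{\mu_1(B(x,r))}\int_{B(x,r)}f\,d\mu_1.$$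 Then $(\mathcal{X},d_1)$ is annular quasi-convex at large scales: there are $R_L,C_L>0$ such that for all $x\in\mathcal{X}$, all $r\ge R_L$ and all $y,z\in B(x,2r)\setminus B(x,r)$ there is a curve (a continuous map $\gamma$ from a compact interval $[a,b]$) in $B(x,C_Lr)\setminus B(x,r/C_L)$ with $\gamma(a)=y$ and $\gamma(b)=z$. -/

import Mathlib

open scoped ENNReal Topology
open MeasureTheory Set

noncomputable section

namespace Cable

/-- An orientation of a simple graph: every edge has a source and a target. -/
structure EdgeOrientation {V : Type*} (G : SimpleGraph V) where
  /-- the source of an edge -/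
  src : G.edgeSet → V
  /-- the target of an edge -/
  tgt : G.edgeSet → V
  /-- every edge is the unordered pair of its source and its target -/
  edge_eq : ∀ e : G.edgeSet, (e : Sym2 V) = s(src e, tgt e)

/-- `G` has polynomial volume growth with exponent `d`: for some `C > 1`, every open ball of radius
`r ≥ 1` in the graph distance is finite, and its cardinality lies between `C⁻¹ r ^ d`
and `C r ^ d`. -/
def HasPolynomialGrowth {V : Type*} (G : SimpleGraph V) (d : ℝ) : Prop :=
  ∃ C : ℝ, 1 < C ∧ ∀ (x : V) (r : ℝ), 1 ≤ r →
    {y : V | (G.dist x y : ℝ) < r}.Finite ∧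
    C⁻¹ * r ^ d ≤ ({y : V | (G.dist x y : ℝ) < r}.ncard : ℝ) ∧
    ({y : V | (G.dist x y : ℝ) < r}.ncard : ℝ) ≤ C * r ^ d

section Construction

variable {V : Type*} {G : SimpleGraph V}

/-- The gluing relation on `E × [0,1]`. -/
inductive Glue (o : EdgeOrientation G) :
    G.edgeSet × unitInterval → G.edgeSet × unitInterval → Prop
  | tgt_src (e e' : G.edgeSet) (h : o.tgt e = o.src e') : Glue o (e, 1) (e', 0)
  | src_src (e e' : G.edgeSet) (h : o.src e = o.src e') : Glue o (e, 0) (e', 0)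
  | tgt_tgt (e e' : G.edgeSet) (h : o.tgt e = o.tgt e') : Glue o (e, 1) (e', 1)

/-- The cable system of `G`: the quotient of `E × [0,1]` by the smallest equivalence relation
that contains the gluing relation. -/
def CableSystem (o : EdgeOrientation G) : Type _ := Quot (Glue o)

variable (o : EdgeOrientation G)

/-- The canonical projection `E × [0,1] → X`. -/
def proj (e : G.edgeSet) (s : unitInterval) : CableSystem o := Quot.mk _ (e, s)

/-- Pseudometrics `ρ` on the cable system with `ρ (e,s) (e,t) ≤ |s - t|` on every edge `e`, that is,
those dominated on each edge by the metric in which the edge has length one. -/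
structure IsEdgeBounded (ρ : CableSystem o → CableSystem o → ℝ) : Prop where
  self : ∀ x, ρ x x = 0
  comm : ∀ x y, ρ x y = ρ y x
  triangle : ∀ x y z, ρ x z ≤ ρ x y + ρ y z
  edge : ∀ (e : G.edgeSet) (s t : unitInterval),
    ρ (proj o e s) (proj o e t) ≤ |(s : ℝ) - (t : ℝ)|

/-- The value at `(x, y)` of the largest pseudometric that is bounded by the unit-length metric on
each edge. -/
def cableDist (x y : CableSystem o) : ℝ :=
  sSup {a : ℝ | ∃ ρ : CableSystem o → CableSystem o → ℝ, IsEdgeBounded o ρ ∧ ρ x y = a}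

variable {o}

theorem IsEdgeBounded.le_one {ρ : CableSystem o → CableSystem o → ℝ} (h : IsEdgeBounded o ρ)
    (e : G.edgeSet) (s t : unitInterval) : ρ (proj o e s) (proj o e t) ≤ 1 := by
  refine (h.edge e s t).trans ?_
  rw [abs_le]
  constructor <;> linarith [s.2.1, s.2.2, t.2.1, t.2.2]

/-- Any two edges with a common vertex have endpoints that are glued. -/
theorem exists_common {e e' : G.edgeSet} {v : V} (hv : v ∈ (e : Sym2 V))
    (hv' : v ∈ (e' : Sym2 V)) : ∃ a b : unitInterval, proj o e a = proj o e' b := by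
  rw [o.edge_eq, Sym2.mem_iff] at hv hv'
  rcases hv with h | h <;> rcases hv' with h' | h'
  · exact ⟨0, 0, Quot.sound (.src_src _ _ (h ▸ h'))⟩
  · exact ⟨0, 1, (Quot.sound (.tgt_src _ _ (h' ▸ h))).symm⟩
  · exact ⟨1, 0, Quot.sound (.tgt_src _ _ (h ▸ h'))⟩
  · exact ⟨1, 1, Quot.sound (.tgt_tgt _ _ (h ▸ h'))⟩

theorem IsEdgeBounded.le_two {ρ : CableSystem o → CableSystem o → ℝ} (h : IsEdgeBounded o ρ)
    {e e' : G.edgeSet} {v : V} (hv : v ∈ (e : Sym2 V)) (hv' : v ∈ (e' : Sym2 V))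
    (s t : unitInterval) : ρ (proj o e s) (proj o e' t) ≤ 2 := by
  obtain ⟨a, b, hab⟩ := exists_common (o := o) hv hv'
  have h1 := h.triangle (proj o e s) (proj o e a) (proj o e' t)
  have h2 := h.le_one e s a
  have h3 := h.le_one e' b t
  rw [← hab] at h3
  linarith

theorem IsEdgeBounded.le_walk {ρ : CableSystem o → CableSystem o → ℝ} (h : IsEdgeBounded o ρ)
    {u v : V} (p : G.Walk u v) : ∀ (e e' : G.edgeSet), u ∈ (e : Sym2 V) → v ∈ (e' : Sym2 V) →
    ∀ s t : unitInterval, ρ (proj o e s) (proj o e' t) ≤ 2 * ((p.length : ℝ) + 1) := by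
  induction p with
  | nil =>
    intro e e' hu hv s t
    simpa using h.le_two hu hv s t
  | @cons u w v hadj p ih =>
    intro e e' hu hv s t
    have h1 := h.le_two (e := e) (e' := ⟨s(u, w), hadj⟩) hu (Sym2.mem_mk_left u w) s 0
    have h2 := ih ⟨s(u, w), hadj⟩ e' (Sym2.mem_mk_right u w) hv 0 t
    have h3 := h.triangle (proj o e s) (proj o ⟨s(u, w), hadj⟩ 0) (proj o e' t)
    rw [SimpleGraph.Walk.length_cons]
    push_cast
    linarith

theorem bddAbove_dist (hG : G.Connected) (x y : CableSystem o) :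
    BddAbove {a : ℝ | ∃ ρ : CableSystem o → CableSystem o → ℝ,
      IsEdgeBounded o ρ ∧ ρ x y = a} := by
  induction x using Quot.ind with | _ x
  induction y using Quot.ind with | _ y
  obtain ⟨e, s⟩ := x
  obtain ⟨e', t⟩ := y
  obtain ⟨p⟩ := hG.preconnected (o.src e) (o.src e')
  refine ⟨2 * ((p.length : ℝ) + 1), ?_⟩
  rintro _ ⟨ρ, hρ, rfl⟩
  exact hρ.le_walk p e e' (by rw [o.edge_eq]; exact Sym2.mem_mk_left _ _)
    (by rw [o.edge_eq]; exact Sym2.mem_mk_left _ _) s t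

theorem isEdgeBounded_zero : IsEdgeBounded o (fun _ _ => 0) :=
  ⟨fun _ => rfl, fun _ _ => rfl, fun _ _ _ => by simp, fun _ _ _ => abs_nonneg _⟩

/-- The largest edge-bounded pseudometric is itself edge-bounded. -/
theorem isEdgeBounded_cableDist (hG : G.Connected) : IsEdgeBounded o (cableDist o) where
  self x := by
    refine le_antisymm (csSup_le ⟨0, _, isEdgeBounded_zero, rfl⟩ ?_)
      (le_csSup (bddAbove_dist hG x x) ⟨_, isEdgeBounded_zero, rfl⟩)
    rintro _ ⟨ρ, hρ, rfl⟩
    exact (hρ.self x).le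
  comm x y := by
    unfold cableDist
    congr 1
    ext a
    exact ⟨fun ⟨ρ, hρ, h⟩ => ⟨ρ, hρ, by rw [hρ.comm, h]⟩,
      fun ⟨ρ, hρ, h⟩ => ⟨ρ, hρ, by rw [hρ.comm, h]⟩⟩
  triangle x y z := by
    refine csSup_le ⟨0, _, isEdgeBounded_zero, rfl⟩ ?_
    rintro _ ⟨ρ, hρ, rfl⟩
    exact (hρ.triangle x y z).trans (add_le_add
      (le_csSup (bddAbove_dist hG x y) ⟨ρ, hρ, rfl⟩)
      (le_csSup (bddAbove_dist hG y z) ⟨ρ, hρ, rfl⟩))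
  edge e s t := by
    refine csSup_le ⟨0, _, isEdgeBounded_zero, rfl⟩ ?_
    rintro _ ⟨ρ, hρ, rfl⟩
    exact hρ.edge e s t

theorem le_cableDist (hG : G.Connected) {ρ : CableSystem o → CableSystem o → ℝ}
    (hρ : IsEdgeBounded o ρ) (x y : CableSystem o) : ρ x y ≤ cableDist o x y :=
  le_csSup (bddAbove_dist hG x y) ⟨ρ, hρ, rfl⟩

/-- A function that is `1`-Lipschitz on every edge is `1`-Lipschitz for the cable distance. -/
theorem abs_sub_le_cableDist (hG : G.Connected) (h : CableSystem o → ℝ)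
    (hh : ∀ (e : G.edgeSet) (s t : unitInterval),
      |h (proj o e s) - h (proj o e t)| ≤ |(s : ℝ) - (t : ℝ)|) (x y : CableSystem o) :
    |h x - h y| ≤ cableDist o x y :=
  le_cableDist hG (ρ := fun x y => |h x - h y|)
    ⟨fun x => by simp, fun x y => abs_sub_comm _ _, fun x y z => abs_sub_le _ _ _, hh⟩ x y

theorem EdgeOrientation.src_ne_tgt (o : EdgeOrientation G) (e : G.edgeSet) : o.src e ≠ o.tgt e := by
  have h : s(o.src e, o.tgt e) ∈ G.edgeSet := o.edge_eq e ▸ e.2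
  exact (G.mem_edgeSet.1 h).ne

open Classical in
/-- A tent function that separates an interior point of an edge from all other points. -/
def tent (o : EdgeOrientation G) (e₀ : G.edgeSet) (s₀ : unitInterval) : CableSystem o → ℝ :=
  Quot.lift (fun p => if p.1 = e₀ then
      max (min (s₀ : ℝ) (1 - s₀) - |(p.2 : ℝ) - s₀|) 0 else 0) (by
    have h0 : max (min (s₀ : ℝ) (1 - s₀) - |((0 : unitInterval) : ℝ) - s₀|) 0 = 0 := by
      refine max_eq_right ?_
      have h1 := min_le_left (s₀ : ℝ) (1 - s₀)
      have h2 := neg_le_abs (((0 : unitInterval) : ℝ) - s₀)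
      have h3 : ((0 : unitInterval) : ℝ) = 0 := rfl
      linarith
    have h1 : max (min (s₀ : ℝ) (1 - s₀) - |((1 : unitInterval) : ℝ) - s₀|) 0 = 0 := by
      refine max_eq_right ?_
      have h1 := min_le_right (s₀ : ℝ) (1 - s₀)
      have h2 := le_abs_self (((1 : unitInterval) : ℝ) - s₀)
      have h3 : ((1 : unitInterval) : ℝ) = 1 := rfl
      linarith
    rintro _ _ (⟨e, e', h⟩ | ⟨e, e', h⟩ | ⟨e, e', h⟩) <;> simp only [h0, h1, ite_self])

open Classical in
/-- A function that separates the vertex `v` from all other points. -/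
def vertexTent (o : EdgeOrientation G) (v : V) : CableSystem o → ℝ :=
  Quot.lift (fun p => if v = o.src p.1 then 1 - (p.2 : ℝ)
      else if v = o.tgt p.1 then (p.2 : ℝ) else 0) (by
    have h0 : ∀ e : G.edgeSet, (if v = o.src e then 1 - ((0 : unitInterval) : ℝ)
      else if v = o.tgt e then ((0 : unitInterval) : ℝ) else 0) = if v = o.src e then 1 else 0 := by
      intro e
      simp
    have h1 : ∀ e : G.edgeSet, (if v = o.src e then 1 - ((1 : unitInterval) : ℝ)
      else if v = o.tgt e then ((1 : unitInterval) : ℝ) else 0) = if v = o.tgt e then 1 else 0 := by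
      intro e
      by_cases hv : v = o.src e
      · have := o.src_ne_tgt e
        simp [hv, this]
      · simp [hv]
    rintro _ _ (⟨e, e', h⟩ | ⟨e, e', h⟩ | ⟨e, e', h⟩)
    · exact (h1 e).trans (h ▸ (h0 e').symm)
    · exact (h0 e).trans (h ▸ (h0 e').symm)
    · exact (h1 e).trans (h ▸ (h1 e').symm))

theorem abs_tent_sub_le (e₀ : G.edgeSet) (s₀ : unitInterval) (e : G.edgeSet)
    (s t : unitInterval) :
    |tent o e₀ s₀ (proj o e s) - tent o e₀ s₀ (proj o e t)| ≤ |(s : ℝ) - (t : ℝ)| := by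
  simp only [tent, proj]
  split_ifs
  · refine (abs_max_sub_max_le_abs _ _ _).trans ?_
    rw [sub_sub_sub_cancel_left]
    refine (abs_abs_sub_abs_le_abs_sub _ _).trans (le_of_eq ?_)
    rw [sub_sub_sub_cancel_right, abs_sub_comm]
  · simp

theorem abs_vertexTent_sub_le (v : V) (e : G.edgeSet) (s t : unitInterval) :
    |vertexTent o v (proj o e s) - vertexTent o v (proj o e t)| ≤ |(s : ℝ) - (t : ℝ)| := by
  simp only [vertexTent, proj]
  split_ifs
  · rw [sub_sub_sub_cancel_left, abs_sub_comm]
  · exact le_rfl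
  · simp

/-- The point `(e, s)` is the vertex `v`. -/
def IsVertexPoint (o : EdgeOrientation G) (v : V) (e : G.edgeSet) (s : unitInterval) : Prop :=
  (s = 0 ∧ v = o.src e) ∨ (s = 1 ∧ v = o.tgt e)

theorem isVertexPoint_iff (v : V) (e : G.edgeSet) (s : unitInterval) :
    vertexTent o v (proj o e s) = 1 ↔ IsVertexPoint o v e s := by
  have hst := o.src_ne_tgt e
  simp only [vertexTent, proj, IsVertexPoint, ← Subtype.val_inj]
  change _ ↔ ((s : ℝ) = 0 ∧ _) ∨ ((s : ℝ) = 1 ∧ _)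
  split_ifs with h1 h2
  · simp [h1, hst]
  · simp [h2, hst.symm]
  · simp [h1, h2]

theorem IsVertexPoint.proj_eq {v : V} {e e' : G.edgeSet} {s t : unitInterval}
    (h : IsVertexPoint o v e s) (h' : IsVertexPoint o v e' t) : proj o e s = proj o e' t := by
  rcases h with ⟨rfl, h⟩ | ⟨rfl, h⟩ <;> rcases h' with ⟨rfl, h'⟩ | ⟨rfl, h'⟩
  · exact Quot.sound (.src_src _ _ (h ▸ h'))
  · exact (Quot.sound (.tgt_src _ _ (h' ▸ h))).symm
  · exact Quot.sound (.tgt_src _ _ (h ▸ h'))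
  · exact Quot.sound (.tgt_tgt _ _ (h ▸ h'))

/-- The cable distance separates points. -/
theorem eq_of_cableDist_eq_zero (hG : G.Connected) (x y : CableSystem o)
    (h : cableDist o x y = 0) : x = y := by
  induction x using Quot.ind with | _ x
  induction y using Quot.ind with | _ y
  obtain ⟨e, s⟩ := x
  obtain ⟨e', t⟩ := y
  change cableDist o (proj o e s) (proj o e' t) = 0 at h
  change proj o e s = proj o e' t
  have key : ∀ v : V, IsVertexPoint o v e s → proj o e s = proj o e' t := by
    intro v hv
    have h1 := abs_sub_le_cableDist hG (vertexTent o v) (abs_vertexTent_sub_le v)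
      (proj o e s) (proj o e' t)
    rw [h, (isVertexPoint_iff v e s).2 hv] at h1
    have h2 : vertexTent o v (proj o e' t) = 1 := by
      have := abs_nonpos_iff.1 h1
      linarith
    exact hv.proj_eq ((isVertexPoint_iff v e' t).1 h2)
  by_cases hs0 : s = 0
  · exact key (o.src e) (Or.inl ⟨hs0, rfl⟩)
  by_cases hs1 : s = 1
  · exact key (o.tgt e) (Or.inr ⟨hs1, rfl⟩)
  have h1 := abs_sub_le_cableDist hG (tent o e s) (abs_tent_sub_le e s)
      (proj o e s) (proj o e' t)
  rw [h] at h1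
  have h2 : 0 < min (s : ℝ) (1 - s) :=
    lt_min (unitInterval.pos_iff_ne_zero.2 hs0)
      (sub_pos.2 (unitInterval.lt_one_iff_ne_one.2 hs1))
  have h3 := abs_nonpos_iff.1 h1
  simp only [tent, proj, if_true, sub_self, abs_zero, sub_zero, max_eq_left h2.le] at h3
  split_ifs at h3 with he
  · have h4 : |(t : ℝ) - s| ≤ 0 := by
      rcases max_cases (min (s : ℝ) (1 - s) - |(t : ℝ) - s|) 0 with h5 | h5 <;> linarith
    have h6 : t = s := Subtype.ext (sub_eq_zero.1 (abs_nonpos_iff.1 h4))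
    rw [he, h6]
  · linarith

/-- The metric `d₁` of the cable system with unit edge lengths. -/
instance instMetricSpace [hG : Fact G.Connected] : MetricSpace (CableSystem o) where
  dist := cableDist o
  dist_self := (isEdgeBounded_cableDist hG.out).self
  dist_comm := (isEdgeBounded_cableDist hG.out).comm
  dist_triangle := (isEdgeBounded_cableDist hG.out).triangle
  eq_of_dist_eq_zero := eq_of_cableDist_eq_zero hG.out _ _

instance instMeasurableSpace [Fact G.Connected] : MeasurableSpace (CableSystem o) := borel _

instance instBorelSpace [Fact G.Connected] : BorelSpace (CableSystem o) := ⟨rfl⟩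

variable (o)

/-- The edge `e` as a curve in the cable system, parametrized by arc length on `[0,1]` (and
extended to the real line by constants). -/
def edgeCurve (e : G.edgeSet) (s : ℝ) : CableSystem o := proj o e (projIcc 0 1 zero_le_one s)

theorem continuous_edgeCurve [hG : Fact G.Connected] (e : G.edgeSet) :
    Continuous (edgeCurve o e) := by
  have h : LipschitzWith 1 (proj o e) := LipschitzWith.of_dist_le_mul fun s t => by
    rw [NNReal.coe_one, one_mul]
    exact (isEdgeBounded_cableDist hG.out).edge e s t
  exact h.continuous.comp continuous_projIcc

/-- The length of the gradient of `f`: at an interior point `(e, s)` of an edge it is the absolute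
value of the derivative of `f` along the edge; at the vertices, which form a null set, it is `0`. -/
def gradLength (f : CableSystem o → ℝ) : CableSystem o → ℝ :=
  Quot.lift (fun p => if 0 < p.2 ∧ p.2 < 1 then |deriv (f ∘ edgeCurve o p.1) (p.2 : ℝ)| else 0) (by
    rintro _ _ (⟨e, e', h⟩ | ⟨e, e', h⟩ | ⟨e, e', h⟩) <;> simp)

/-- Absolutely continuous functions on the cable system: continuous functions that are absolutely
continuous along every edge. -/
def IsAbsCont [Fact G.Connected] (f : CableSystem o → ℝ) : Prop :=
  Continuous f ∧ ∀ e : G.edgeSet, AbsolutelyContinuousOnInterval (f ∘ edgeCurve o e) 0 1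

/-- The measure `μ₁` of the cable system: Lebesgue measure on each edge, no mass at vertices. -/
def cableMeasure [Fact G.Connected] : Measure (CableSystem o) :=
  Measure.sum fun e : G.edgeSet => (volume.restrict (Icc (0 : ℝ) 1)).map (edgeCurve o e)

/-- The energy of `f` in the set `A`, that is, the mass that the energy measure
`|∇ f|² dμ₁` gives to `A`. -/
def energyOn [Fact G.Connected] (f : CableSystem o → ℝ) (A : Set (CableSystem o)) : ℝ≥0∞ :=
  ∫⁻ x in A, ENNReal.ofReal (gradLength o f x ^ 2) ∂(cableMeasure o)

/-- The Dirichlet energy of `f`. -/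
def energy [Fact G.Connected] (f : CableSystem o → ℝ) : ℝ≥0∞ := energyOn o f univ

/-- The square of the form norm: Dirichlet energy plus the square of the `L²` norm. -/
def formNormSq [Fact G.Connected] (f : CableSystem o → ℝ) : ℝ≥0∞ :=
  energy o f + ∫⁻ x, ENNReal.ofReal (f x ^ 2) ∂(cableMeasure o)

/-- The closure of a set `S` of absolutely continuous functions in the form norm. Its elements are
represented by their absolutely continuous versions. -/
def formClosure [Fact G.Connected] (S : Set (CableSystem o → ℝ)) : Set (CableSystem o → ℝ) :=
  {f | IsAbsCont o f ∧ ∀ ε : ℝ≥0∞, 0 < ε → ∃ g ∈ S, formNormSq o (f - g) < ε}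

/-- Continuous functions with compact support contained in `D`. -/
def compactlySupportedIn [Fact G.Connected] (D : Set (CableSystem o)) :
    Set (CableSystem o → ℝ) :=
  {f | Continuous f ∧ HasCompactSupport f ∧ tsupport f ⊆ D}

/-- The domain of the Dirichlet form: the closure in the form norm of the compactly supported
absolutely continuous functions of finite energy. -/
def formDomain [Fact G.Connected] : Set (CableSystem o → ℝ) :=
  formClosure o ({f | IsAbsCont o f ∧ energy o f < ∞} ∩ compactlySupportedIn o univ)

/-- The part of the form domain on `D`: the closure in the form norm of the functions of the form
domain that are continuous with compact support in `D`. -/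
def formDomainOn [Fact G.Connected] (D : Set (CableSystem o)) : Set (CableSystem o → ℝ) :=
  formClosure o (formDomain o ∩ compactlySupportedIn o D)

/-- The capacity of `A` in `D`: the infimum of the energies of the functions in the part of the form
domain on `D` that are at least `1` in a neighbourhood of `A` (`∞` if there is none). -/
def capacity [Fact G.Connected] (D A : Set (CableSystem o)) : ℝ≥0∞ :=
  ⨅ f ∈ {f | f ∈ formDomainOn o D ∧ ∃ U, IsOpen U ∧ A ⊆ U ∧ ∀ x ∈ U, 1 ≤ f x}, energy o f

/-- The capacity upper bound: the capacity of `B(x, r)` in `B(x, M r)` is at most `C`, for all points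
`x` and all `r ≥ 1`. -/
def CapacityUpperBound [Fact G.Connected] : Prop :=
  ∃ C M : ℝ, 1 ≤ C ∧ 1 ≤ M ∧ ∀ (x : CableSystem o) (r : ℝ), 1 ≤ r →
    capacity o (Metric.ball x (M * r)) (Metric.ball x r) ≤ ENNReal.ofReal C

/-- The Poincaré inequality with scale function `Ψ`. -/
def PoincareInequality [Fact G.Connected] (Ψ : ℝ → ℝ) : Prop :=
  ∃ C M : ℝ, 1 ≤ C ∧ 1 ≤ M ∧ ∀ f ∈ formDomain o, ∀ (x : CableSystem o) (r : ℝ), 0 < r →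
    ENNReal.ofReal r < Metric.ediam (univ : Set (CableSystem o)) / 2 →
    ∫⁻ y in Metric.ball x r,
        ENNReal.ofReal ((f y - ⨍ z in Metric.ball x r, f z ∂(cableMeasure o)) ^ 2)
        ∂(cableMeasure o) ≤
      ENNReal.ofReal (C * Ψ r) * energyOn o f (Metric.ball x (M * r))

end Construction

/-- Annular quasi-convexity at large scales of a metric space. -/
def AnnularQuasiConvexAtLargeScales (X : Type*) [MetricSpace X] : Prop :=
  ∃ R C : ℝ, 0 < R ∧ 0 < C ∧ ∀ (x : X) (r : ℝ), R ≤ r →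
    ∀ y ∈ Metric.ball x (2 * r) \ Metric.ball x r,
    ∀ z ∈ Metric.ball x (2 * r) \ Metric.ball x r,
      ∃ γ : Path y z, ∀ t, γ t ∈ Metric.ball x (C * r) \ Metric.ball x (r / C)

end Cable

end

/-! Suppose two points of an annulus cannot be joined in a thicker annulus. Then a function of small
energy separates them, while the Poincaré inequality forces every such function to have energy
bounded below, uniformly in the scale.

Small energy: the capacity of a ball in a larger concentric ball is bounded at every scale. The
average of cutoffs at `n` geometrically separated scales, whose gradients live on disjoint sets of
edges, has energy of order `1 / n` (`exists_cutoff_small`). A difference of two such averages is a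
function `h` equal to `1` on an annulus and `0` far from it (`exists_annular_cutoff`). Cutting `h`
down to one component of its positivity set does not increase the energy
(`abs_indicator_component_sub_le`). If `y` and `z` lie in different components, the geodesics from
them towards the centre show that the restricted function takes both values `0` and `1` at every
distance between `N` and `2 * N`.

Large energy: balls of radius `R ≥ 1` have volume at least of order `R ^ d` and `Ψ R = R ^ d`, so
the Poincaré inequality bounds squared differences of means over comparable balls by the energy
alone. Telescoping over radii `4 ^ k` shows that a point value is close to the mean over a large
ball unless some ball around the point carries energy at least of the order of radius over `N`
(`abs_sub_ballMean_lt_half`). One of the values `0`, `1` is far from the mean, so such balls occur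
at every distance between `N` and `2 * N`; a Vitali covering yields total energy bounded below
(`le_energy_of_forall_exists_ball`). Large `n` gives the contradiction.

The argument runs on the vertices: restriction to vertices does not increase energy, and affine
interpolation preserves it. -/

noncomputable section

namespace Cable

/-! ### Vertices, distances, finiteness and measure in the cable system -/

section Geometry

variable {V : Type*} {G : SimpleGraph V} {o : EdgeOrientation G}

/-- The cable system is built from edges only, so a vertex is visible in it through an incident
edge; `Nontrivial V` and connectedness supply one. -/
theorem exists_isVertexPoint [hG : Fact G.Connected] [Nontrivial V] (o : EdgeOrientation G)
    (v : V) : ∃ p : G.edgeSet × unitInterval, IsVertexPoint o v p.1 p.2 := by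
  obtain ⟨w, hw⟩ := hG.out.preconnected.exists_adj_of_nontrivial v
  have h := o.edge_eq ⟨s(v, w), hw⟩
  have hv : v ∈ s(o.src ⟨s(v, w), hw⟩, o.tgt ⟨s(v, w), hw⟩) := h ▸ Sym2.mem_mk_left v w
  rcases Sym2.mem_iff.1 hv with h | h
  · exact ⟨(_, 0), Or.inl ⟨rfl, h⟩⟩
  · exact ⟨(_, 1), Or.inr ⟨rfl, h⟩⟩

/-- The point of the cable system that corresponds to a vertex. -/
def vtx [Fact G.Connected] [Nontrivial V] (o : EdgeOrientation G) (v : V) : CableSystem o :=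
  proj o (exists_isVertexPoint o v).choose.1 (exists_isVertexPoint o v).choose.2

theorem IsVertexPoint.vtx_eq [Fact G.Connected] [Nontrivial V] {v : V} {e : G.edgeSet}
    {s : unitInterval} (h : IsVertexPoint o v e s) : vtx o v = proj o e s :=
  (exists_isVertexPoint o v).choose_spec.proj_eq h

theorem vtx_src [Fact G.Connected] [Nontrivial V] (e : G.edgeSet) :
    vtx o (o.src e) = proj o e 0 :=
  IsVertexPoint.vtx_eq (Or.inl ⟨rfl, rfl⟩)

theorem vtx_tgt [Fact G.Connected] [Nontrivial V] (e : G.edgeSet) :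
    vtx o (o.tgt e) = proj o e 1 :=
  IsVertexPoint.vtx_eq (Or.inr ⟨rfl, rfl⟩)

theorem EdgeOrientation.adj (o : EdgeOrientation G) (e : G.edgeSet) :
    G.Adj (o.src e) (o.tgt e) := by
  have h : s(o.src e, o.tgt e) ∈ G.edgeSet := o.edge_eq e ▸ e.2
  exact h

theorem EdgeOrientation.exists_edge (o : EdgeOrientation G) {u v : V} (h : G.Adj u v) :
    ∃ e : G.edgeSet, (o.src e = u ∧ o.tgt e = v) ∨ (o.src e = v ∧ o.tgt e = u) := by
  refine ⟨⟨s(u, v), h⟩, ?_⟩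
  have := o.edge_eq ⟨s(u, v), h⟩
  rcases Sym2.eq_iff.1 this with ⟨h1, h2⟩ | ⟨h1, h2⟩
  · exact Or.inl ⟨h1.symm, h2.symm⟩
  · exact Or.inr ⟨h2.symm, h1.symm⟩

theorem EdgeOrientation.edge_ext (o : EdgeOrientation G) {e e' : G.edgeSet}
    (h1 : o.src e = o.src e') (h2 : o.tgt e = o.tgt e') : e = e' :=
  Subtype.ext (by rw [o.edge_eq e, o.edge_eq e', h1, h2])

theorem exists_proj (p : CableSystem o) : ∃ e s, proj o e s = p := by
  induction p using Quot.ind with | _ p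
  exact ⟨p.1, p.2, rfl⟩

/-- The extension of a function on the vertices that is affine on every edge. -/
def interp (o : EdgeOrientation G) (F : V → ℝ) : CableSystem o → ℝ :=
  Quot.lift (fun p => (1 - (p.2 : ℝ)) * F (o.src p.1) + p.2 * F (o.tgt p.1)) (by
    rintro _ _ (⟨e, e', h⟩ | ⟨e, e', h⟩ | ⟨e, e', h⟩) <;> simp [h])

theorem interp_proj (F : V → ℝ) (e : G.edgeSet) (s : unitInterval) :
    interp o F (proj o e s) = (1 - (s : ℝ)) * F (o.src e) + s * F (o.tgt e) := rfl

theorem interp_sub_interp (F : V → ℝ) (e : G.edgeSet) (s t : unitInterval) :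
    interp o F (proj o e s) - interp o F (proj o e t) =
      (s - t : ℝ) * (F (o.tgt e) - F (o.src e)) := by
  rw [interp_proj, interp_proj]; ring

theorem IsVertexPoint.interp_eq {v : V} {e : G.edgeSet} {s : unitInterval}
    (h : IsVertexPoint o v e s) (F : V → ℝ) : interp o F (proj o e s) = F v := by
  rcases h with ⟨rfl, rfl⟩ | ⟨rfl, rfl⟩ <;> simp [interp_proj]

/-- The tool for lower bounds on `dist`: since the metric is the largest one, any function that is
`1`-Lipschitz along the edges is a test function for it. -/
theorem abs_interp_sub_le [hG : Fact G.Connected] {F : V → ℝ}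
    (hF : ∀ u v, G.Adj u v → |F u - F v| ≤ 1) (p q : CableSystem o) :
    |interp o F p - interp o F q| ≤ dist p q := by
  refine abs_sub_le_cableDist hG.out _ (fun e s t => ?_) p q
  rw [interp_sub_interp, abs_mul]
  exact mul_le_of_le_one_right (abs_nonneg _) (hF _ _ (o.adj e).symm)

theorem dist_proj_le [hG : Fact G.Connected] (e : G.edgeSet) (s t : unitInterval) :
    dist (proj o e s) (proj o e t) ≤ |(s : ℝ) - t| :=
  (isEdgeBounded_cableDist hG.out).edge e s t

theorem dist_proj_le_one [hG : Fact G.Connected] (e : G.edgeSet) (s t : unitInterval) :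
    dist (proj o e s) (proj o e t) ≤ 1 :=
  (isEdgeBounded_cableDist hG.out).le_one e s t

theorem proj_injective (e : G.edgeSet) : Function.Injective (proj o e) := by
  intro s t h
  have := congrArg (vertexTent o (o.src e)) h
  simp only [vertexTent, proj, if_true] at this
  exact Subtype.ext (by linarith)

theorem continuous_proj [hG : Fact G.Connected] (e : G.edgeSet) : Continuous (proj o e) :=
  (LipschitzWith.of_dist_le_mul (K := 1) fun s t => by
    rw [NNReal.coe_one, one_mul]; exact dist_proj_le e s t).continuous

theorem measurableEmbedding_proj [Fact G.Connected] (e : G.edgeSet) :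
    MeasurableEmbedding (proj o e) :=
  ((continuous_proj e).isClosedEmbedding (proj_injective e)).measurableEmbedding

theorem abs_dist_sub_dist_le_one (hG : G.Connected) (x : V) {u v : V} (h : G.Adj u v) :
    |(G.dist x u : ℝ) - G.dist x v| ≤ 1 := by
  have h1 := hG.dist_triangle (u := x) (v := u) (w := v)
  have h2 := hG.dist_triangle (u := x) (v := v) (w := u)
  rw [SimpleGraph.dist_eq_one_iff_adj.2 h] at h1
  rw [SimpleGraph.dist_eq_one_iff_adj.2 h.symm] at h2
  have h1' : (G.dist x v : ℝ) ≤ G.dist x u + 1 := by exact_mod_cast h1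
  have h2' : (G.dist x u : ℝ) ≤ G.dist x v + 1 := by exact_mod_cast h2
  rw [abs_le]
  constructor <;> linarith

theorem interp_vtx [Fact G.Connected] [Nontrivial V] (F : V → ℝ) (v : V) :
    interp o F (vtx o v) = F v :=
  (exists_isVertexPoint o v).choose_spec.interp_eq F

theorem dist_vtx_adj_le [Fact G.Connected] [Nontrivial V] {u v : V} (h : G.Adj u v) :
    dist (vtx o u) (vtx o v) ≤ 1 := by
  obtain ⟨e, ⟨rfl, rfl⟩ | ⟨rfl, rfl⟩⟩ := o.exists_edge h
  · rw [vtx_src, vtx_tgt]; exact dist_proj_le_one e _ _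
  · rw [vtx_src, vtx_tgt]; exact dist_proj_le_one e _ _

theorem dist_vtx_le_length [Fact G.Connected] [Nontrivial V] {u v : V} (p : G.Walk u v) :
    dist (vtx o u) (vtx o v) ≤ p.length := by
  induction p with
  | nil => simp
  | @cons u w v h p ih =>
    have h1 := dist_triangle (vtx o u) (vtx o w) (vtx o v)
    have h2 := dist_vtx_adj_le (o := o) h
    rw [SimpleGraph.Walk.length_cons]
    push_cast
    linarith

/-- The cable distance extends the graph distance. -/
theorem dist_vtx [hG : Fact G.Connected] [Nontrivial V] (u v : V) :
    dist (vtx o u) (vtx o v) = G.dist u v := by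
  apply le_antisymm
  · obtain ⟨p, hp⟩ := hG.out.exists_walk_length_eq_dist u v
    rw [← hp]
    exact dist_vtx_le_length p
  · have h := abs_interp_sub_le (o := o) (F := fun w => (G.dist u w : ℝ))
      (fun a b hab => abs_dist_sub_dist_le_one hG.out u hab) (vtx o v) (vtx o u)
    rw [interp_vtx, interp_vtx, SimpleGraph.dist_self, Nat.cast_zero, sub_zero,
      abs_of_nonneg (Nat.cast_nonneg _), dist_comm] at h
    exact h

theorem dist_vtx_src_proj_le [Fact G.Connected] [Nontrivial V] (e : G.edgeSet)
    (s : unitInterval) : dist (vtx o (o.src e)) (proj o e s) ≤ 1 := by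
  rw [vtx_src]; exact dist_proj_le_one e _ _

theorem dist_vtx_tgt_proj_le [Fact G.Connected] [Nontrivial V] (e : G.edgeSet)
    (s : unitInterval) : dist (vtx o (o.tgt e)) (proj o e s) ≤ 1 := by
  rw [vtx_tgt]; exact dist_proj_le_one e _ _

theorem finite_edges_of_finite (o : EdgeOrientation G) {S : Set V} (hS : S.Finite) :
    {e : G.edgeSet | o.src e ∈ S ∧ o.tgt e ∈ S}.Finite := by
  refine Finite.of_finite_image (f := fun e => (o.src e, o.tgt e))
    ((hS.prod hS).subset ?_) ?_
  · rintro _ ⟨e, he, rfl⟩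
    exact he
  · intro e _ e' _ h
    exact o.edge_ext (congrArg Prod.fst h) (congrArg Prod.snd h)

theorem HasPolynomialGrowth.finite_ball {d : ℝ} (h : HasPolynomialGrowth G d) (x : V) (r : ℝ) :
    {y : V | (G.dist x y : ℝ) < r}.Finite := by
  obtain ⟨C, -, hC⟩ := h
  exact (hC x (max r 1) (le_max_right _ _)).1.subset fun y hy =>
    lt_of_lt_of_le (show (G.dist x y : ℝ) < r from hy) (le_max_left _ _)

theorem HasPolynomialGrowth.exists_le_dist {d : ℝ} (hd : 0 < d) (h : HasPolynomialGrowth G d)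
    (x : V) (r : ℝ) : ∃ y, r ≤ G.dist x y := by
  by_contra! hr
  obtain ⟨C, hC1, hC⟩ := h
  have huniv : ∀ s, r ≤ s → {y : V | (G.dist x y : ℝ) < s} = univ := fun s hs =>
    eq_univ_of_forall fun y => (hr y).trans_le hs
  have hlim : Filter.Tendsto (fun s : ℝ => C⁻¹ * s ^ d) Filter.atTop Filter.atTop :=
    (tendsto_rpow_atTop hd).const_mul_atTop (by positivity)
  obtain ⟨s, hs, hsr, hs1⟩ := ((hlim.eventually_gt_atTop ((univ : Set V).ncard : ℝ)).and
    ((Filter.eventually_ge_atTop r).and (Filter.eventually_ge_atTop 1))).exists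
  have := (hC x s hs1).2.1
  rw [huniv s hsr] at this
  linarith

theorem HasPolynomialGrowth.nontrivial {d : ℝ} (hd : 0 < d) (h : HasPolynomialGrowth G d)
    (hG : G.Connected) : Nontrivial V := by
  obtain ⟨x⟩ := hG.nonempty
  obtain ⟨y, hy⟩ := h.exists_le_dist hd x 1
  refine ⟨x, y, ?_⟩
  rintro rfl
  rw [SimpleGraph.dist_self] at hy
  norm_num at hy

/-- Makes the restriction on the radius in the Poincaré inequality void. -/
theorem ediam_univ_eq_top [Fact G.Connected] [Nontrivial V] {d : ℝ} (hd : 0 < d)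
    (h : HasPolynomialGrowth G d) : Metric.ediam (univ : Set (CableSystem o)) = ∞ := by
  obtain ⟨x⟩ : Nonempty V := inferInstance
  by_contra hne
  obtain ⟨y, hy⟩ := h.exists_le_dist hd x ((Metric.ediam (univ : Set (CableSystem o))).toReal + 1)
  have h1 : edist (vtx o x) (vtx o y) ≤ Metric.ediam (univ : Set (CableSystem o)) :=
    Metric.edist_le_ediam_of_mem (mem_univ _) (mem_univ _)
  have h2 := ENNReal.toReal_mono hne h1
  rw [edist_dist, ENNReal.toReal_ofReal dist_nonneg, dist_vtx] at h2
  linarith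

theorem finite_edges_meeting_ball [Fact G.Connected] [Nontrivial V] {d : ℝ}
    (h : HasPolynomialGrowth G d) (x : CableSystem o) (r : ℝ) :
    {e : G.edgeSet | ∃ s, dist (proj o e s) x < r}.Finite := by
  obtain ⟨e₀, s₀, rfl⟩ := exists_proj x
  refine (finite_edges_of_finite o (h.finite_ball (o.src e₀) (r + 3))).subset ?_
  rintro e ⟨s, hs⟩
  have h1 := dist_vtx_src_proj_le (o := o) e₀ s₀
  have h2 := dist_vtx_src_proj_le (o := o) e s
  have h3 := dist_vtx_tgt_proj_le (o := o) e s
  rw [dist_comm] at hs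
  constructor
  · have := dist_triangle4 (vtx o (o.src e₀)) (proj o e₀ s₀) (proj o e s) (vtx o (o.src e))
    rw [dist_vtx, dist_comm (proj o e s)] at this
    simp only [mem_ofPred_eq]
    linarith
  · have := dist_triangle4 (vtx o (o.src e₀)) (proj o e₀ s₀) (proj o e s) (vtx o (o.tgt e))
    rw [dist_vtx, dist_comm (proj o e s)] at this
    simp only [mem_ofPred_eq]
    linarith

theorem isCompact_iUnion_edges [Fact G.Connected] {S : Set G.edgeSet} (hS : S.Finite) :
    IsCompact (⋃ e ∈ S, range (proj o e)) :=
  hS.isCompact_biUnion fun e _ => isCompact_range (continuous_proj e)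

/-- No measurability of `f` is needed because `proj o e`, continuous and injective on a compact
space, is a measurable embedding. -/
theorem lintegral_cableMeasure [Fact G.Connected] (f : CableSystem o → ℝ≥0∞) :
    ∫⁻ x, f x ∂(cableMeasure o) = ∑' e, ∫⁻ s : unitInterval, f (proj o e s) := by
  rw [cableMeasure, lintegral_sum_measure]
  congr 1
  ext e
  have h : (volume.restrict (Icc (0 : ℝ) 1)).map (edgeCurve o e) =
      (volume : Measure unitInterval).map (proj o e) := by
    have := unitInterval.measurePreserving_coe.map_eq
    rw [← this, Measure.map_map (continuous_edgeCurve o e).measurable measurable_subtype_coe]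
    congr 1
    ext s
    simp [edgeCurve]
  rw [h, (measurableEmbedding_proj e).lintegral_map]

theorem setLIntegral_cableMeasure [Fact G.Connected] (f : CableSystem o → ℝ≥0∞)
    {A : Set (CableSystem o)} (hA : MeasurableSet A) :
    ∫⁻ x in A, f x ∂(cableMeasure o) =
      ∑' e, ∫⁻ s : unitInterval, A.indicator f (proj o e s) := by
  rw [← lintegral_indicator hA, lintegral_cableMeasure]

theorem cableMeasure_apply [Fact G.Connected] {A : Set (CableSystem o)} (hA : MeasurableSet A) :
    cableMeasure o A = ∑' e, volume (proj o e ⁻¹' A) := by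
  rw [← lintegral_indicator_one hA, lintegral_cableMeasure]
  congr 1
  ext e
  rw [← lintegral_indicator_one ((continuous_proj e).measurable hA)]
  rfl

theorem cableMeasure_ball_lt_top [Fact G.Connected] [Nontrivial V] {d : ℝ}
    (h : HasPolynomialGrowth G d) (x : CableSystem o) (r : ℝ) :
    cableMeasure o (Metric.ball x r) < ∞ := by
  have hfin := finite_edges_meeting_ball h x r
  rw [cableMeasure_apply Metric.isOpen_ball.measurableSet,
    tsum_eq_sum (s := hfin.toFinset) ?_]
  · exact ENNReal.sum_lt_top.2 fun e _ => measure_lt_top _ _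
  · intro e he
    rw [Finite.mem_toFinset] at he
    have : proj o e ⁻¹' Metric.ball x r = ∅ := by
      ext s
      simp only [mem_preimage, Metric.mem_ball, mem_empty_iff_false, iff_false]
      exact fun hs => he ⟨s, hs⟩
    rw [this, measure_empty]

end Geometry

/-! ### Energy on edges, pointwise control by the form norm, cutoffs on vertices -/

section Energy

theorem lintegral_sq_le_of_measure_univ_le_one {α : Type*} [MeasurableSpace α] {μ : Measure α}
    (hμ : μ univ ≤ 1) {f : α → ℝ≥0∞} (hf : AEMeasurable f μ) :
    (∫⁻ x, f x ∂μ) ^ 2 ≤ ∫⁻ x, f x ^ 2 ∂μ := by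
  have h := ENNReal.lintegral_mul_le_Lp_mul_Lq μ Real.HolderConjugate.two_two hf
    (aemeasurable_const (b := (1 : ℝ≥0∞)))
  simp only [Pi.mul_apply, mul_one, ENNReal.one_rpow, lintegral_const, one_mul] at h
  have h1 : μ univ ^ (1 / 2 : ℝ) ≤ 1 := ENNReal.rpow_le_one hμ (by norm_num)
  have h2 : ∫⁻ x, f x ∂μ ≤ (∫⁻ x, f x ^ (2 : ℝ) ∂μ) ^ (1 / 2 : ℝ) :=
    h.trans (mul_le_of_le_one_right zero_le h1)
  calc (∫⁻ x, f x ∂μ) ^ 2 ≤ ((∫⁻ x, f x ^ (2 : ℝ) ∂μ) ^ (1 / 2 : ℝ)) ^ 2 := by gcongr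
    _ = ∫⁻ x, f x ^ (2 : ℝ) ∂μ := by
      rw [← ENNReal.rpow_natCast, ← ENNReal.rpow_mul]; norm_num
    _ = ∫⁻ x, f x ^ 2 ∂μ := by
      simp only [← ENNReal.rpow_natCast, Nat.cast_ofNat]

/-- The fundamental theorem of calculus for absolutely continuous functions, followed by
Cauchy–Schwarz on an interval of length one. -/
theorem ofReal_sq_sub_le_lintegral_deriv {u : ℝ → ℝ}
    (hu : AbsolutelyContinuousOnInterval u 0 1) {a b : ℝ} (ha : a ∈ Icc (0 : ℝ) 1)
    (hb : b ∈ Icc (0 : ℝ) 1) :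
    ENNReal.ofReal ((u b - u a) ^ 2) ≤ ∫⁻ x in Icc (0 : ℝ) 1, ENNReal.ofReal (deriv u x ^ 2) := by
  wlog hab : a ≤ b generalizing a b
  · have := this hb ha (le_of_not_ge hab)
    rwa [show (u b - u a) ^ 2 = (u a - u b) ^ 2 by ring]
  have hu' : AbsolutelyContinuousOnInterval u a b := hu.mono (by
    rw [uIcc_of_le hab, uIcc_of_le zero_le_one]; exact Icc_subset_Icc ha.1 hb.2)
  have h1 : ‖u b - u a‖ₑ ≤ ∫⁻ x in Icc (0 : ℝ) 1, ‖deriv u x‖ₑ := by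
    rw [← hu'.integral_deriv_eq_sub, intervalIntegral.integral_of_le hab]
    exact (enorm_integral_le_lintegral_enorm _).trans (lintegral_mono_set
      (Ioc_subset_Icc_self.trans (Icc_subset_Icc ha.1 hb.2)))
  have hsq : ∀ x : ℝ, ENNReal.ofReal (x ^ 2) = ‖x‖ₑ ^ 2 := fun x => by
    rw [Real.enorm_eq_ofReal_abs, ← ENNReal.ofReal_pow (abs_nonneg _), sq_abs]
  simp only [hsq]
  calc ‖u b - u a‖ₑ ^ 2 ≤ (∫⁻ x in Icc (0 : ℝ) 1, ‖deriv u x‖ₑ) ^ 2 := by gcongr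
    _ ≤ _ := lintegral_sq_le_of_measure_univ_le_one (by simp)
      (measurable_deriv u).enorm.aemeasurable

variable {V : Type*} {G : SimpleGraph V} {o : EdgeOrientation G}

/-- The energy of a function on the vertices: the sum of its squared increments along the edges. -/
def vertexEnergy (o : EdgeOrientation G) (F : V → ℝ) : ℝ≥0∞ :=
  ∑' e, ENNReal.ofReal ((F (o.tgt e) - F (o.src e)) ^ 2)

theorem ae_unitInterval : ∀ᵐ s : unitInterval, 0 < s ∧ s < 1 := by
  filter_upwards [compl_mem_ae_iff.2 (measure_singleton (0 : unitInterval)),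
    compl_mem_ae_iff.2 (measure_singleton (1 : unitInterval))] with s h0 h1
  exact ⟨unitInterval.pos_iff_ne_zero.2 h0, unitInterval.lt_one_iff_ne_one.2 h1⟩

theorem gradLength_proj (f : CableSystem o → ℝ) (e : G.edgeSet) {s : unitInterval}
    (hs : 0 < s ∧ s < 1) : gradLength o f (proj o e s) = |deriv (f ∘ edgeCurve o e) (s : ℝ)| :=
  if_pos hs

theorem edgeCurve_coe (e : G.edgeSet) (s : unitInterval) : edgeCurve o e s = proj o e s := by
  simp [edgeCurve]

theorem gradLength_interp (F : V → ℝ) (e : G.edgeSet) {s : unitInterval} (hs : 0 < s ∧ s < 1) :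
    gradLength o (interp o F) (proj o e s) = |F (o.tgt e) - F (o.src e)| := by
  rw [gradLength_proj _ _ hs]
  have h : (interp o F ∘ edgeCurve o e) =ᶠ[𝓝 (s : ℝ)]
      fun x => F (o.src e) + x * (F (o.tgt e) - F (o.src e)) := by
    filter_upwards [Ioo_mem_nhds (show (0 : ℝ) < s from hs.1) (show (s : ℝ) < 1 from hs.2)]
      with x hx
    have hx' : x ∈ Icc (0 : ℝ) 1 := ⟨hx.1.le, hx.2.le⟩
    simp only [Function.comp, edgeCurve, projIcc_of_mem zero_le_one hx', interp_proj]
    ring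
  rw [h.deriv_eq]
  simp

theorem energyOn_interp [Fact G.Connected] (F : V → ℝ) {A : Set (CableSystem o)}
    (hA : MeasurableSet A) :
    energyOn o (interp o F) A =
      ∑' e, ENNReal.ofReal ((F (o.tgt e) - F (o.src e)) ^ 2) * volume (proj o e ⁻¹' A) := by
  rw [energyOn, setLIntegral_cableMeasure _ hA]
  congr 1
  ext e
  have hm := (continuous_proj (o := o) e).measurable hA
  rw [← lintegral_indicator_const hm]
  refine lintegral_congr_ae ?_
  filter_upwards [ae_unitInterval] with s hs
  by_cases h : s ∈ proj o e ⁻¹' A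
  · rw [indicator_of_mem h, indicator_of_mem (mem_preimage.1 h), gradLength_interp F e hs, sq_abs]
  · rw [indicator_of_notMem h, indicator_of_notMem (fun h' => h (mem_preimage.2 h'))]

theorem energy_interp [Fact G.Connected] (F : V → ℝ) :
    energy o (interp o F) = vertexEnergy o F := by
  simp [energy, energyOn_interp F MeasurableSet.univ, vertexEnergy]

theorem le_energyOn_interp [Fact G.Connected] (F : V → ℝ) {A : Set (CableSystem o)}
    (hA : MeasurableSet A) (e : G.edgeSet) (he : ∀ s, proj o e s ∈ A) :
    ENNReal.ofReal ((F (o.tgt e) - F (o.src e)) ^ 2) ≤ energyOn o (interp o F) A := by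
  rw [energyOn_interp F hA]
  refine le_trans ?_ (ENNReal.le_tsum e)
  rw [show proj o e ⁻¹' A = univ from eq_univ_of_forall he, measure_univ, mul_one]

theorem lintegral_edge_gradLength (f : CableSystem o → ℝ) (e : G.edgeSet) :
    ∫⁻ s : unitInterval, ENNReal.ofReal (gradLength o f (proj o e s) ^ 2) =
      ∫⁻ x in Icc (0 : ℝ) 1, ENNReal.ofReal (deriv (f ∘ edgeCurve o e) x ^ 2) := by
  rw [← unitInterval.measurePreserving_coe.lintegral_comp_emb
    unitInterval.measurableEmbedding_coe]
  refine lintegral_congr_ae ?_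
  filter_upwards [ae_unitInterval] with s hs
  rw [gradLength_proj f e hs, sq_abs]

theorem IsAbsCont.sq_sub_le [Fact G.Connected] {f : CableSystem o → ℝ} (hf : IsAbsCont o f)
    (e : G.edgeSet) (s t : unitInterval) :
    ENNReal.ofReal ((f (proj o e t) - f (proj o e s)) ^ 2) ≤
      ∫⁻ s : unitInterval, ENNReal.ofReal (gradLength o f (proj o e s) ^ 2) := by
  rw [lintegral_edge_gradLength]
  have := ofReal_sq_sub_le_lintegral_deriv (hf.2 e) s.2 t.2
  simpa only [Function.comp, edgeCurve_coe] using this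

theorem energy_eq_tsum [Fact G.Connected] (f : CableSystem o → ℝ) :
    energy o f =
      ∑' e, ∫⁻ s : unitInterval, ENNReal.ofReal (gradLength o f (proj o e s) ^ 2) := by
  rw [energy, energyOn, Measure.restrict_univ, lintegral_cableMeasure]

theorem vertexEnergy_comp_vtx_le [Fact G.Connected] [Nontrivial V] {f : CableSystem o → ℝ}
    (hf : IsAbsCont o f) : vertexEnergy o (fun v => f (vtx o v)) ≤ energy o f := by
  rw [energy_eq_tsum]
  refine ENNReal.tsum_le_tsum fun e => ?_
  simp only [vtx_src, vtx_tgt]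
  exact hf.sq_sub_le e 0 1

/-- Sobolev embedding on one unit edge: compare `f p` with `f q` for `q` on the same edge and
average over `q`. Hence convergence in the form norm implies pointwise convergence. -/
theorem IsAbsCont.sq_le_formNormSq [Fact G.Connected] {f : CableSystem o → ℝ}
    (hf : IsAbsCont o f) (p : CableSystem o) :
    ENNReal.ofReal (f p ^ 2) ≤ 2 * formNormSq o f := by
  obtain ⟨e, s, rfl⟩ := exists_proj p
  set I := ∫⁻ s : unitInterval, ENNReal.ofReal (gradLength o f (proj o e s) ^ 2)
  have h1 : ∀ t : unitInterval, ENNReal.ofReal (f (proj o e s) ^ 2) ≤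
      2 * ENNReal.ofReal (f (proj o e t) ^ 2) + 2 * I := fun t => by
    refine le_trans ?_ (add_le_add_right (mul_le_mul_right (hf.sq_sub_le e t s) 2) _)
    rw [← ENNReal.ofReal_ofNat 2, ← ENNReal.ofReal_mul zero_le_two,
      ← ENNReal.ofReal_mul zero_le_two, ← ENNReal.ofReal_add (by positivity) (by positivity)]
    apply ENNReal.ofReal_le_ofReal
    nlinarith [sq_nonneg (2 * f (proj o e t) - f (proj o e s))]
  have h2 : ENNReal.ofReal (f (proj o e s) ^ 2) ≤
      2 * (∫⁻ t : unitInterval, ENNReal.ofReal (f (proj o e t) ^ 2)) + 2 * I := by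
    calc ENNReal.ofReal (f (proj o e s) ^ 2)
        = ∫⁻ _ : unitInterval, ENNReal.ofReal (f (proj o e s) ^ 2) := by simp
      _ ≤ ∫⁻ t : unitInterval, (2 * ENNReal.ofReal (f (proj o e t) ^ 2) + 2 * I) :=
        lintegral_mono h1
      _ = _ := by
        rw [lintegral_add_right _ measurable_const, lintegral_const_mul' _ _ (by simp)]
        simp
  refine h2.trans ?_
  rw [← mul_add, formNormSq, energy_eq_tsum, lintegral_cableMeasure, add_comm]
  gcongr
  · exact ENNReal.le_tsum (f := fun e => ∫⁻ s : unitInterval,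
      ENNReal.ofReal (gradLength o f (proj o e s) ^ 2)) e
  · exact ENNReal.le_tsum (f := fun e => ∫⁻ s : unitInterval,
      ENNReal.ofReal (f (proj o e s) ^ 2)) e

theorem IsAbsCont.sub [Fact G.Connected] {f g : CableSystem o → ℝ} (hf : IsAbsCont o f)
    (hg : IsAbsCont o g) : IsAbsCont o (f - g) :=
  ⟨hf.1.sub hg.1, fun e => (hf.2 e).sub (hg.2 e)⟩

/-- The approximating functions vanish off `D`, and the form norm controls point values. -/
theorem eq_zero_of_mem_formDomainOn [Fact G.Connected] {D : Set (CableSystem o)}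
    {f : CableSystem o → ℝ} (hf : f ∈ formDomainOn o D) {p : CableSystem o} (hp : p ∉ D) :
    f p = 0 := by
  have key : ∀ ε : ℝ≥0∞, 0 < ε → ENNReal.ofReal (f p ^ 2) ≤ 2 * ε := by
    intro ε hε
    obtain ⟨g, ⟨hg, -, -, hgD⟩, hfg⟩ := hf.2 ε hε
    have hgp : g p = 0 := image_eq_zero_of_notMem_tsupport fun h => hp (hgD h)
    have := (hf.1.sub hg.1).sq_le_formNormSq p
    rw [Pi.sub_apply, hgp, sub_zero] at this
    exact this.trans (by gcongr)
  have h0 : ENNReal.ofReal (f p ^ 2) = 0 := by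
    by_contra hne
    have h1 := key (ENNReal.ofReal (f p ^ 2) / 4)
      (ENNReal.div_pos hne (by norm_num))
    have h2 : 2 * (ENNReal.ofReal (f p ^ 2) / 4) = ENNReal.ofReal (f p ^ 2 / 2) := by
      rw [← ENNReal.ofReal_ofNat 2, ← ENNReal.ofReal_ofNat 4,
        ← ENNReal.ofReal_div_of_pos (by norm_num), ← ENNReal.ofReal_mul (by norm_num)]
      congr 1; ring
    rw [h2, ENNReal.ofReal_le_ofReal_iff (by positivity)] at h1
    apply hne
    rw [show f p ^ 2 = 0 by nlinarith [sq_nonneg (f p)], ENNReal.ofReal_zero]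
  rw [ENNReal.ofReal_eq_zero] at h0
  exact pow_eq_zero_iff two_ne_zero |>.1 (le_antisymm h0 (sq_nonneg _))

theorem vertexEnergy_mono {F H : V → ℝ}
    (h : ∀ u v, G.Adj u v → |F v - F u| ≤ |H v - H u|) :
    vertexEnergy o F ≤ vertexEnergy o H :=
  ENNReal.tsum_le_tsum fun e => ENNReal.ofReal_le_ofReal (sq_le_sq.2 (h _ _ (o.adj e)))

theorem abs_clamp_sub_clamp_le (a b : ℝ) :
    |max 0 (min 1 a) - max 0 (min 1 b)| ≤ |a - b| := by
  have h1 := abs_max_sub_max_le_abs (min 1 a) (min 1 b) 0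
  rw [max_comm, max_comm _ (0 : ℝ)] at h1
  refine h1.trans ?_
  rw [min_comm, min_comm 1 b]
  exact abs_min_sub_min_le_max a 1 b 1 |>.trans (by simp)

/-- The capacity upper bound gives cutoff functions on the vertices. -/
theorem CapacityUpperBound.exists_cutoff [Fact G.Connected] [Nontrivial V]
    (h : CapacityUpperBound o) : ∃ C M : ℝ, 1 ≤ C ∧ 1 ≤ M ∧ ∀ (x : V) (r : ℝ), 1 ≤ r →
      ∃ F : V → ℝ, (∀ v, F v ∈ Icc (0 : ℝ) 1) ∧ (∀ v, (G.dist x v : ℝ) < r → F v = 1) ∧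
        (∀ v, M * r ≤ (G.dist x v : ℝ) → F v = 0) ∧ vertexEnergy o F ≤ ENNReal.ofReal C := by
  obtain ⟨C, M, hC, hM, h⟩ := h
  -- The infimum need not be attained; the room between `C` and `C + 1` provides an actual
  -- competitor.
  refine ⟨C + 1, M, by linarith, hM, fun x r hr => ?_⟩
  have h1 : capacity o (Metric.ball (vtx o x) (M * r)) (Metric.ball (vtx o x) r) <
      ENNReal.ofReal (C + 1) :=
    (h (vtx o x) r hr).trans_lt ((ENNReal.ofReal_lt_ofReal_iff (by linarith)).2 (by linarith))
  obtain ⟨f, hf⟩ := iInf_lt_iff.1 h1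
  obtain ⟨⟨hfD, U, -, hU, hf1⟩, hfE⟩ := iInf_lt_iff.1 hf
  refine ⟨fun v => max 0 (min 1 (f (vtx o v))), fun v => ⟨le_max_left _ _, ?_⟩, fun v hv => ?_,
    fun v hv => ?_, ?_⟩
  · exact max_le zero_le_one (min_le_left _ _)
  · have : 1 ≤ f (vtx o v) := hf1 _ (hU (by rwa [Metric.mem_ball, dist_comm, dist_vtx]))
    simp [this]
  · have : f (vtx o v) = 0 := eq_zero_of_mem_formDomainOn hfD (by
      rwa [Metric.mem_ball, dist_comm, dist_vtx, not_lt])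
    simp [this]
  · refine le_trans ?_ ((vertexEnergy_comp_vtx_le hfD.1).trans hfE.le)
    exact vertexEnergy_mono fun u v _ => abs_clamp_sub_clamp_le _ _

end Energy

/-! ### Cutoff functions of small energy and components of positivity sets -/

section Cutoff

variable {V : Type*} {G : SimpleGraph V} {o : EdgeOrientation G}

theorem vertexEnergy_sub_le (F H : V → ℝ) :
    vertexEnergy o (F - H) ≤ 2 * vertexEnergy o F + 2 * vertexEnergy o H := by
  simp only [vertexEnergy]
  rw [← ENNReal.tsum_mul_left, ← ENNReal.tsum_mul_left, ← ENNReal.tsum_add]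
  refine ENNReal.tsum_le_tsum fun e => ?_
  rw [← ENNReal.ofReal_ofNat 2, ← ENNReal.ofReal_mul zero_le_two,
    ← ENNReal.ofReal_mul zero_le_two, ← ENNReal.ofReal_add (by positivity) (by positivity)]
  apply ENNReal.ofReal_le_ofReal
  simp only [Pi.sub_apply]
  nlinarith [sq_nonneg (F (o.tgt e) - F (o.src e) + (H (o.tgt e) - H (o.src e)))]

/-- If the functions `F j` vary on disjoint sets of edges, then the energy of their mean
is the sum of their energies divided by `n ^ 2`. -/
theorem vertexEnergy_mean_le (F : ℕ → V → ℝ) {n : ℕ} (hn : 0 < n) {C : ℝ}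
    (hF : ∀ j < n, vertexEnergy o (F j) ≤ ENNReal.ofReal C)
    (hdisj : ∀ u v, G.Adj u v → ∀ i j, F i v ≠ F i u → F j v ≠ F j u → i = j) :
    vertexEnergy o (fun v => (n : ℝ)⁻¹ * ∑ j ∈ Finset.range n, F j v) ≤
      ENNReal.ofReal (C / n) := by
  have hsq : ∀ e, ENNReal.ofReal (((n : ℝ)⁻¹ * ∑ j ∈ Finset.range n, F j (o.tgt e) -
      (n : ℝ)⁻¹ * ∑ j ∈ Finset.range n, F j (o.src e)) ^ 2) =
      ENNReal.ofReal (((n : ℝ)⁻¹) ^ 2) * ∑ j ∈ Finset.range n,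
        ENNReal.ofReal ((F j (o.tgt e) - F j (o.src e)) ^ 2) := by
    intro e
    rw [← ENNReal.ofReal_sum_of_nonneg fun _ _ => sq_nonneg _,
      ← ENNReal.ofReal_mul (sq_nonneg _), ← mul_sub, ← Finset.sum_sub_distrib, mul_pow]
    congr 2
    -- On each edge at most one summand has a nonzero increment, so the square of the sum is the sum
    -- of the squares.
    by_cases h : ∃ j ∈ Finset.range n, F j (o.tgt e) ≠ F j (o.src e)
    · obtain ⟨j, hj, hne⟩ := h
      have h0 : ∀ i ∈ Finset.range n, i ≠ j → F i (o.tgt e) - F i (o.src e) = 0 := by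
        intro i _ hij
        by_contra hi
        exact hij (hdisj _ _ (o.adj e) i j (sub_ne_zero.1 hi) hne)
      rw [Finset.sum_eq_single j h0 (fun h => absurd hj h),
        Finset.sum_eq_single j (fun i hi hij => by rw [h0 i hi hij]; ring) (fun h => absurd hj h)]
    · push Not at h
      rw [Finset.sum_eq_zero fun j hj => by rw [h j hj, sub_self],
        Finset.sum_eq_zero fun j hj => by rw [h j hj, sub_self]; ring]
      ring
  rw [vertexEnergy, tsum_congr hsq, ENNReal.tsum_mul_left,
    Summable.tsum_finsetSum fun _ _ => ENNReal.summable]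
  have hn' : (0 : ℝ) < n := by exact_mod_cast hn
  calc _ ≤ ENNReal.ofReal (((n : ℝ)⁻¹) ^ 2) * ∑ _j ∈ Finset.range n, ENNReal.ofReal C := by
        gcongr with j hj
        exact hF j (Finset.mem_range.1 hj)
    _ = ENNReal.ofReal (C / n) := by
        rw [Finset.sum_const, Finset.card_range, nsmul_eq_mul, ← ENNReal.ofReal_natCast,
          ← ENNReal.ofReal_mul hn'.le, ← ENNReal.ofReal_mul (sq_nonneg _)]
        congr 1
        field_simp

/-- Averaging cutoff functions over many scales gives cutoff functions of small energy. -/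
theorem exists_cutoff_small (hG : G.Connected) {C M : ℝ} (hM : 1 ≤ M)
    (h : ∀ (x : V) (r : ℝ), 1 ≤ r →
      ∃ F : V → ℝ, (∀ v, F v ∈ Icc (0 : ℝ) 1) ∧ (∀ v, (G.dist x v : ℝ) < r → F v = 1) ∧
        (∀ v, M * r ≤ (G.dist x v : ℝ) → F v = 0) ∧ vertexEnergy o F ≤ ENNReal.ofReal C)
    {n : ℕ} (hn : 0 < n) (x : V) {r : ℝ} (hr : 1 ≤ r) :
    ∃ F : V → ℝ, (∀ v, F v ∈ Icc (0 : ℝ) 1) ∧ (∀ v, (G.dist x v : ℝ) < r → F v = 1) ∧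
      (∀ v, r * (2 * M) ^ n ≤ (G.dist x v : ℝ) → F v = 0) ∧
      vertexEnergy o F ≤ ENNReal.ofReal (C / n) := by
  have hL : 1 ≤ 2 * M := by linarith
  have hrj : ∀ j : ℕ, r ≤ r * (2 * M) ^ j := fun j =>
    le_mul_of_one_le_right (by linarith) (one_le_pow₀ hL)
  choose F h01 h1 h0 hE using fun j : ℕ => h x (r * (2 * M) ^ j) (hr.trans (hrj j))
  have hn' : (0 : ℝ) < n := by exact_mod_cast hn
  -- The outer end of an edge where `F j` varies identifies `j`. The factor `2` in `2 * M` absorbs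
  -- the edges that straddle the radius `M * (r * (2 * M) ^ j)`, since this radius is at least `1`.
  have hvary : ∀ u v, G.Adj u v → ∀ j, F j v ≠ F j u →
      r * (2 * M) ^ j ≤ max (G.dist x u : ℝ) (G.dist x v) ∧
      max (G.dist x u : ℝ) (G.dist x v) < r * (2 * M) ^ (j + 1) := by
    intro u v huv j hne
    have hd := abs_le.1 (abs_dist_sub_dist_le_one hG x huv)
    constructor
    · by_contra! hlt
      exact hne ((h1 j v ((le_max_right _ _).trans_lt hlt)).trans
        (h1 j u ((le_max_left _ _).trans_lt hlt)).symm)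
    · have hmin : (G.dist x u : ℝ) < M * (r * (2 * M) ^ j) ∨
          (G.dist x v : ℝ) < M * (r * (2 * M) ^ j) := by
        by_contra! hge
        exact hne ((h0 j v hge.2).trans (h0 j u hge.1).symm)
      have hMr : 1 ≤ M * (r * (2 * M) ^ j) :=
        one_le_mul_of_one_le_of_one_le hM (hr.trans (hrj j))
      have he : r * (2 * M) ^ (j + 1) = 2 * (M * (r * (2 * M) ^ j)) := by ring
      rw [he]
      rcases hmin with h | h <;> exact max_lt (by linarith) (by linarith)
  refine ⟨fun v => (n : ℝ)⁻¹ * ∑ j ∈ Finset.range n, F j v, fun v => ⟨?_, ?_⟩, fun v hv => ?_,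
    fun v hv => ?_, vertexEnergy_mean_le F hn (fun j _ => hE j) ?_⟩
  · exact mul_nonneg (by positivity) (Finset.sum_nonneg fun j _ => (h01 j v).1)
  · rw [inv_mul_le_iff₀ hn', mul_one]
    refine (Finset.sum_le_sum fun j _ => (h01 j v).2).trans ?_
    simp
  · simp only
    rw [Finset.sum_congr rfl fun j _ => h1 j v (hv.trans_le (hrj j))]
    simp [hn'.ne']
  · simp only
    rw [Finset.sum_eq_zero, mul_zero]
    intro j hj
    apply h0 j v
    refine le_trans ?_ hv
    have : (2 * M) ^ (j + 1) ≤ (2 * M) ^ n := pow_le_pow_right₀ hL (Finset.mem_range.1 hj)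
    have h2 : 0 ≤ r * (2 * M) ^ j * M := by positivity
    calc M * (r * (2 * M) ^ j) ≤ r * (2 * M) ^ (j + 1) := by rw [pow_succ]; linarith
      _ ≤ _ := by gcongr
  · intro u v huv i j hi hj
    have hpow : ∀ i j : ℕ, i < j → r * (2 * M) ^ (i + 1) ≤ r * (2 * M) ^ j := fun i j hij => by
      gcongr
      exact hij
    obtain ⟨hi1, hi2⟩ := hvary u v huv i hi
    obtain ⟨hj1, hj2⟩ := hvary u v huv j hj
    rcases lt_trichotomy i j with hij | hij | hij
    · linarith [hpow i j hij]
    · exact hij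
    · linarith [hpow j i hij]

/-- Functions of small energy that are `1` in an annulus and `0` far away from it. -/
theorem exists_annular_cutoff (hG : G.Connected) {C M : ℝ} (hM : 1 ≤ M)
    (h : ∀ (x : V) (r : ℝ), 1 ≤ r →
      ∃ F : V → ℝ, (∀ v, F v ∈ Icc (0 : ℝ) 1) ∧ (∀ v, (G.dist x v : ℝ) < r → F v = 1) ∧
        (∀ v, M * r ≤ (G.dist x v : ℝ) → F v = 0) ∧ vertexEnergy o F ≤ ENNReal.ofReal C)
    {n : ℕ} (hn : 0 < n) (x : V) {s t : ℝ} (hs : 1 ≤ s) (hst : s * (2 * M) ^ n ≤ t) :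
    ∃ F : V → ℝ, (∀ v, F v ∈ Icc (0 : ℝ) 1) ∧
      (∀ v, s * (2 * M) ^ n ≤ (G.dist x v : ℝ) → (G.dist x v : ℝ) < t → F v = 1) ∧
      (∀ v, (G.dist x v : ℝ) < s → F v = 0) ∧
      (∀ v, t * (2 * M) ^ n ≤ (G.dist x v : ℝ) → F v = 0) ∧
      vertexEnergy o F ≤ 4 * ENNReal.ofReal (C / n) := by
  have hpow : 1 ≤ (2 * M) ^ n := one_le_pow₀ (by linarith)
  have hs' : s ≤ s * (2 * M) ^ n := le_mul_of_one_le_right (by linarith) hpow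
  have ht' : t ≤ t * (2 * M) ^ n := le_mul_of_one_le_right (by linarith) hpow
  obtain ⟨φ, φ01, φ1, φ0, φE⟩ := exists_cutoff_small hG hM h hn x hs
  obtain ⟨ψ, ψ01, ψ1, ψ0, ψE⟩ := exists_cutoff_small hG hM h hn x (r := t) (by linarith)
  -- By `hst`, `ψ = 1` wherever `φ ≠ 0`, so the difference stays in `[0, 1]`.
  refine ⟨ψ - φ, fun v => ?_, fun v h1 h2 => ?_, fun v hv => ?_, fun v hv => ?_, ?_⟩
  · have := φ01 v
    have := ψ01 v
    simp only [Pi.sub_apply, mem_Icc] at *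
    rcases lt_or_ge (G.dist x v : ℝ) t with hlt | hge
    · rw [ψ1 v hlt]
      constructor <;> linarith
    · rw [φ0 v (hst.trans hge)]
      constructor <;> linarith
  · rw [Pi.sub_apply, ψ1 v h2, φ0 v h1, sub_zero]
  · rw [Pi.sub_apply, ψ1 v (by linarith), φ1 v hv, sub_self]
  · rw [Pi.sub_apply, ψ0 v hv, φ0 v (by linarith), sub_self]
  · refine (vertexEnergy_sub_le ψ φ).trans ?_
    calc 2 * vertexEnergy o ψ + 2 * vertexEnergy o φ
        ≤ 2 * ENNReal.ofReal (C / n) + 2 * ENNReal.ofReal (C / n) := by gcongr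
      _ = 4 * ENNReal.ofReal (C / n) := by ring

/-- Adjacency of vertices in the set where `h` is positive. -/
def PosAdj (G : SimpleGraph V) (h : V → ℝ) (u v : V) : Prop :=
  G.Adj u v ∧ 0 < h u ∧ 0 < h v

/-- Restricting a nonnegative function to a component of its positivity set does not increase its
increments. -/
theorem abs_indicator_component_sub_le {h : V → ℝ} (h0 : ∀ v, 0 ≤ h v) (y : V) {u v : V}
    (huv : G.Adj u v) :
    |{w | Relation.ReflTransGen (PosAdj G h) y w}.indicator h v -
      {w | Relation.ReflTransGen (PosAdj G h) y w}.indicator h u| ≤ |h v - h u| := by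
  set U := {w | Relation.ReflTransGen (PosAdj G h) y w}
  -- Otherwise the edge would be a `PosAdj` step extending the component.
  have key : ∀ {a b}, G.Adj a b → a ∈ U → b ∉ U → h a = 0 ∨ h b = 0 := by
    intro a b hab ha hb
    by_contra! hne
    exact hb (Relation.ReflTransGen.tail ha ⟨hab, (h0 a).lt_of_ne hne.1.symm,
      (h0 b).lt_of_ne hne.2.symm⟩)
  by_cases hu : u ∈ U <;> by_cases hv : v ∈ U
  · rw [indicator_of_mem hu, indicator_of_mem hv]
  · rw [indicator_of_mem hu, indicator_of_notMem hv]
    rcases key huv hu hv with h | h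
    · simp [h]
    · simp [h]
  · rw [indicator_of_notMem hu, indicator_of_mem hv]
    rcases key huv.symm hv hu with h | h
    · simp [h]
    · simp [h]
  · rw [indicator_of_notMem hu, indicator_of_notMem hv]
    simp

end Cutoff

/-! ### Means over balls and the Poincaré inequality -/

section Averages

variable {V : Type*} {G : SimpleGraph V} {o : EdgeOrientation G}

theorem abs_sub_le_one_of_mem_Icc {a b : ℝ} (ha : a ∈ Icc (0 : ℝ) 1) (hb : b ∈ Icc (0 : ℝ) 1) :
    |a - b| ≤ 1 := by
  rw [abs_le]
  constructor <;> linarith [ha.1, ha.2, hb.1, hb.2]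

theorem interp_mem_Icc {F : V → ℝ} (hF : ∀ v, F v ∈ Icc (0 : ℝ) 1) (p : CableSystem o) :
    interp o F p ∈ Icc (0 : ℝ) 1 := by
  obtain ⟨e, s, rfl⟩ := exists_proj p
  rw [interp_proj]
  have h1 := hF (o.src e)
  have h2 := hF (o.tgt e)
  have hs := s.2
  constructor
  · exact add_nonneg (mul_nonneg (by linarith [hs.2]) h1.1) (mul_nonneg hs.1 h2.1)
  · nlinarith [hs.1, hs.2, h1.2, h2.2, mul_nonneg hs.1 (sub_nonneg.2 h2.2),
      mul_nonneg (sub_nonneg.2 hs.2) (sub_nonneg.2 h1.2)]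

theorem continuous_interp [Fact G.Connected] {F : V → ℝ} (hF : ∀ v, F v ∈ Icc (0 : ℝ) 1) :
    Continuous (interp o F) :=
  (LipschitzWith.of_dist_le_mul (K := 1) fun p q => by
    rw [NNReal.coe_one, one_mul, Real.dist_eq]
    exact abs_interp_sub_le (fun u v _ => abs_sub_le_one_of_mem_Icc (hF u) (hF v)) p q).continuous

theorem finite_edges_meeting_finite (o : EdgeOrientation G) {d : ℝ}
    (hgrowth : HasPolynomialGrowth G d) {S : Set V} (hS : S.Finite) :
    {e : G.edgeSet | o.src e ∈ S ∨ o.tgt e ∈ S}.Finite := by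
  have hT : (⋃ v ∈ S, {y : V | (G.dist v y : ℝ) < 2}).Finite :=
    hS.biUnion fun v _ => hgrowth.finite_ball v 2
  refine (finite_edges_of_finite o hT).subset ?_
  intro e he
  have h1 : G.dist (o.src e) (o.tgt e) = 1 := SimpleGraph.dist_eq_one_iff_adj.2 (o.adj e)
  have h2 : G.dist (o.tgt e) (o.src e) = 1 := SimpleGraph.dist_eq_one_iff_adj.2 (o.adj e).symm
  rcases he with he | he
  · exact ⟨mem_biUnion he (by simp), mem_biUnion he (by simp [h1])⟩
  · exact ⟨mem_biUnion he (by simp [h2]), mem_biUnion he (by simp)⟩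

/-- Admits finitely supported vertex functions as test functions in the Poincaré inequality. The
extension is itself compactly supported with finite energy, so it is its own approximation. -/
theorem interp_mem_formDomain [Fact G.Connected] {d : ℝ}
    (hgrowth : HasPolynomialGrowth G d) {F : V → ℝ} (hF : ∀ v, F v ∈ Icc (0 : ℝ) 1)
    (hfin : F.support.Finite) : interp o F ∈ formDomain o := by
  have hE := finite_edges_meeting_finite o hgrowth hfin
  have hcont := continuous_interp (o := o) hF
  have hac : IsAbsCont o (interp o F) := by
    refine ⟨hcont, fun e => LipschitzOnWith.absolutelyContinuousOnInterval (K := 1) ?_⟩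
    refine LipschitzOnWith.of_dist_le_mul fun x _ y _ => ?_
    rw [NNReal.coe_one, one_mul, Real.dist_eq]
    refine (abs_interp_sub_le (fun u v _ => abs_sub_le_one_of_mem_Icc (hF u) (hF v)) _ _).trans ?_
    refine (dist_proj_le e _ _).trans ?_
    exact (LipschitzWith.projIcc (a := (0 : ℝ)) (b := 1) zero_le_one).dist_le_mul x y |>.trans
      (by simp)
  have hsupp : tsupport (interp o F) ⊆
      ⋃ e ∈ {e : G.edgeSet | o.src e ∈ F.support ∨ o.tgt e ∈ F.support}, range (proj o e) := by
    refine closure_minimal ?_ (isCompact_iUnion_edges hE).isClosed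
    intro p hp
    obtain ⟨e, s, rfl⟩ := exists_proj p
    refine mem_biUnion (x := e) ?_ ⟨s, rfl⟩
    by_contra hne
    simp only [mem_ofPred_eq, Function.mem_support, not_or, not_not] at hne
    exact hp (by rw [interp_proj, hne.1, hne.2]; ring)
  refine ⟨hac, fun ε hε => ⟨interp o F, ⟨⟨hac, ?_⟩, hcont, ?_, subset_univ _⟩, ?_⟩⟩
  · rw [energy_interp, vertexEnergy, tsum_eq_sum (s := hE.toFinset)]
    · exact ENNReal.sum_lt_top.2 fun _ _ => ENNReal.ofReal_lt_top
    · intro e he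
      simp only [Finite.mem_toFinset, mem_ofPred_eq, Function.mem_support, not_or, not_not] at he
      simp [he.1, he.2]
  · exact (isCompact_iUnion_edges hE).of_isClosed_subset (isClosed_tsupport _) hsupp
  · have h0 : formNormSq o (0 : CableSystem o → ℝ) = 0 := by
      rw [formNormSq, energy_eq_tsum]
      have : ∀ e : G.edgeSet, ∫⁻ s : unitInterval,
          ENNReal.ofReal (gradLength o (0 : CableSystem o → ℝ) (proj o e s) ^ 2) = 0 := by
        intro e
        rw [lintegral_edge_gradLength]
        have : (0 : CableSystem o → ℝ) ∘ edgeCurve o e = fun _ => 0 := rfl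
        simp [this]
      simp [this]
    rw [sub_self, h0]
    exact hε

/-- Interior points of an edge at `u` are at distance less than `1` from `u`, and `G.dist v u + 1 ≤
n` by integrality; only endpoints, a null set, may be missed. -/
theorem one_le_volume_preimage_ball [Fact G.Connected] [Nontrivial V] {u v : V} {n : ℕ}
    (hu : G.dist v u < n) {e : G.edgeSet} (he : u = o.src e ∨ u = o.tgt e) :
    1 ≤ volume (proj o e ⁻¹' Metric.ball (vtx o v) n) := by
  rw [← measure_univ (μ := (volume : Measure unitInterval))]
  refine measure_mono_ae ?_
  filter_upwards [ae_unitInterval] with s hs _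
  change dist (proj o e s) (vtx o v) < n
  have h1 : (G.dist v u : ℝ) + 1 ≤ n := by exact_mod_cast hu
  have h2 := dist_triangle (proj o e s) (vtx o u) (vtx o v)
  rw [dist_vtx u v, SimpleGraph.dist_comm] at h2
  have hs0 : (0 : ℝ) < s := hs.1
  have hs1 : (s : ℝ) < 1 := hs.2
  have h3 : dist (proj o e s) (vtx o u) < 1 := by
    rcases he with rfl | rfl
    · rw [vtx_src]
      refine (dist_proj_le e s 0).trans_lt ?_
      rw [Icc.coe_zero, sub_zero, abs_of_pos hs0]
      exact hs1
    · rw [vtx_tgt]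
      refine (dist_proj_le e s 1).trans_lt ?_
      rw [Icc.coe_one, abs_of_neg (by linarith)]
      linarith
  linarith

/-- The volume of balls around vertices is bounded below by the number of their vertices. -/
theorem ncard_le_cableMeasure_ball [Fact G.Connected] [Nontrivial V] {d : ℝ}
    (hgrowth : HasPolynomialGrowth G d) (v : V) (n : ℕ) :
    ({y : V | (G.dist v y : ℝ) < n}.ncard : ℝ≥0∞) ≤
      2 * cableMeasure o (Metric.ball (vtx o v) n) := by
  classical
  have hfin := hgrowth.finite_ball v n
  set S := hfin.toFinset
  choose E hE using fun u => exists_isVertexPoint o u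
  have hE' : ∀ u, u = o.src (E u).1 ∨ u = o.tgt (E u).1 := fun u => (hE u).imp And.right And.right
  set T := S.image fun u => (E u).1
  -- An edge can be the chosen one only for its two ends.
  have hcard : S.card ≤ 2 * T.card := by
    refine Finset.card_le_mul_card_image S 2 fun e _ => ?_
    refine (Finset.card_le_card (t := {o.src e, o.tgt e}) ?_).trans Finset.card_le_two
    intro u hu
    obtain ⟨-, rfl⟩ := Finset.mem_filter.1 hu
    simpa using hE' u
  have hT : (T.card : ℝ≥0∞) ≤ cableMeasure o (Metric.ball (vtx o v) n) := by
    rw [cableMeasure_apply Metric.isOpen_ball.measurableSet]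
    refine le_trans ?_ (ENNReal.sum_le_tsum T)
    rw [Finset.card_eq_sum_ones, Nat.cast_sum]
    refine Finset.sum_le_sum fun e he => ?_
    obtain ⟨u, hu, rfl⟩ := Finset.mem_image.1 he
    rw [Nat.cast_one]
    refine one_le_volume_preimage_ball (u := u) ?_ (hE' u)
    have : (G.dist v u : ℝ) < n := by simpa [S] using hu
    exact_mod_cast this
  rw [ncard_eq_toFinset_card _ hfin]
  calc (S.card : ℝ≥0∞) ≤ ((2 * T.card : ℕ) : ℝ≥0∞) := by exact_mod_cast hcard
    _ = 2 * (T.card : ℝ≥0∞) := by push_cast; rfl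
    _ ≤ _ := by gcongr

theorem exists_le_cableMeasure_ball [Fact G.Connected] [Nontrivial V] {d : ℝ}
    (hgrowth : HasPolynomialGrowth G d) : ∃ c : ℝ, 0 < c ∧ ∀ (v : V) (n : ℕ), 1 ≤ n →
      ENNReal.ofReal (c * (n : ℝ) ^ d) ≤ cableMeasure o (Metric.ball (vtx o v) n) := by
  obtain ⟨C, hC1, hC⟩ := id hgrowth
  refine ⟨C⁻¹ / 2, by positivity, fun v n hn => ?_⟩
  have h1 := (hC v n (by exact_mod_cast hn)).2.1
  have h2 := ncard_le_cableMeasure_ball (o := o) hgrowth v n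
  rw [← ENNReal.ofReal_natCast] at h2
  have h3 := (ENNReal.ofReal_le_ofReal h1).trans h2
  rw [show C⁻¹ * (n : ℝ) ^ d = 2 * (C⁻¹ / 2 * (n : ℝ) ^ d) by ring,
    ENNReal.ofReal_mul zero_le_two, ENNReal.ofReal_ofNat] at h3
  exact (ENNReal.mul_le_mul_iff_right (by simp) (by simp)).1 h3

/-- Jensen's inequality for the normalized restriction of `μ` to `B`. -/
theorem ofReal_sq_setAverage_sub_mul_le {α : Type*} [MeasurableSpace α] {μ : Measure α}
    {B : Set α} (h0 : μ B ≠ 0) (h1 : μ B ≠ ∞) {f : α → ℝ} (hf : IntegrableOn f B μ) (c : ℝ) :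
    ENNReal.ofReal ((⨍ x in B, f x ∂μ - c) ^ 2) * μ B ≤
      ∫⁻ x in B, ENNReal.ofReal ((f x - c) ^ 2) ∂μ := by
  set ν : Measure α := (μ B)⁻¹ • μ.restrict B with hν
  have hprob : ν univ = 1 := by
    simp [hν, ENNReal.inv_mul_cancel h0 h1]
  have : IsProbabilityMeasure ν := ⟨hprob⟩
  have hfν : Integrable f ν := hf.smul_measure (ENNReal.inv_ne_top.2 h0)
  have hsq : ∀ x : ℝ, ENNReal.ofReal (x ^ 2) = ‖x‖ₑ ^ 2 := fun x => by
    rw [Real.enorm_eq_ofReal_abs, ← ENNReal.ofReal_pow (abs_nonneg _), sq_abs]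
  have havg : ⨍ x in B, f x ∂μ - c = ∫ x, (f x - c) ∂ν := by
    rw [setAverage_eq', ← hν, integral_sub hfν (integrable_const c), integral_const,
      probReal_univ, one_smul]
  have hle : ‖∫ x, (f x - c) ∂ν‖ₑ ^ 2 ≤ ∫⁻ x, ‖f x - c‖ₑ ^ 2 ∂ν :=
    calc _ ≤ (∫⁻ x, ‖f x - c‖ₑ ∂ν) ^ 2 := by
          gcongr
          exact enorm_integral_le_lintegral_enorm _
      _ ≤ _ := lintegral_sq_le_of_measure_univ_le_one hprob.le
          (hfν.aestronglyMeasurable.aemeasurable.sub_const c).enorm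
  simp only [hsq]
  rw [havg]
  refine (mul_le_mul_left hle _).trans (le_of_eq ?_)
  rw [hν, lintegral_smul_measure, smul_eq_mul, mul_comm, ← mul_assoc,
    ENNReal.mul_inv_cancel h0 h1, one_mul]

theorem integrableOn_interp_ball [Fact G.Connected] [Nontrivial V] {d : ℝ}
    (hgrowth : HasPolynomialGrowth G d) {F : V → ℝ} (hF : ∀ v, F v ∈ Icc (0 : ℝ) 1)
    (x : CableSystem o) (r : ℝ) :
    IntegrableOn (interp o F) (Metric.ball x r) (cableMeasure o) := by
  refine Measure.integrableOn_of_bounded (M := 1) (cableMeasure_ball_lt_top hgrowth x r).ne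
    (continuous_interp hF).aestronglyMeasurable (Filter.Eventually.of_forall fun p => ?_)
  rw [Real.norm_eq_abs, abs_of_nonneg (interp_mem_Icc hF p).1]
  exact (interp_mem_Icc hF p).2

/-- The mean of the extension of `F` over the ball of radius `4 ^ k` around a vertex. -/
def ballMean [Fact G.Connected] [Nontrivial V] (o : EdgeOrientation G) (F : V → ℝ) (v : V)
    (k : ℕ) : ℝ :=
  ⨍ z in Metric.ball (vtx o v) ((4 ^ k : ℕ) : ℝ), interp o F z ∂(cableMeasure o)

theorem cableMeasure_ball_ne_zero [Fact G.Connected] [Nontrivial V] {d : ℝ}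
    (hgrowth : HasPolynomialGrowth G d) (v : V) {n : ℕ} (hn : 1 ≤ n) :
    cableMeasure o (Metric.ball (vtx o v) n) ≠ 0 := by
  obtain ⟨c, hc, h⟩ := exists_le_cableMeasure_ball (o := o) hgrowth
  refine ((ENNReal.ofReal_pos.2 ?_).trans_le (h v n hn)).ne'
  have : (0 : ℝ) < n := by exact_mod_cast hn
  positivity

/-- The Poincaré inequality bounds the difference of the means over two balls of comparable
radius. -/
theorem PoincareInequality.exists_ballMean_sub_le [Fact G.Connected] [Nontrivial V] {d : ℝ}
    (hd : 2 ≤ d) (hgrowth : HasPolynomialGrowth G d)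
    (hPI : PoincareInequality o (fun r => max (r ^ 2) (r ^ d))) :
    ∃ C M : ℝ, 1 ≤ C ∧ 1 ≤ M ∧ ∀ F : V → ℝ, (∀ v, F v ∈ Icc (0 : ℝ) 1) → F.support.Finite →
      ∀ (w x : V) (k : ℕ), (G.dist w x : ℝ) ≤ 3 * 4 ^ k → ∀ b : ℝ, 0 ≤ b →
      energyOn o (interp o F) (Metric.ball (vtx o x) (M * 4 ^ (k + 1))) ≤ ENNReal.ofReal b →
      (ballMean o F w k - ballMean o F x (k + 1)) ^ 2 ≤ C * b := by
  obtain ⟨c, hc, hvol⟩ := exists_le_cableMeasure_ball (o := o) hgrowth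
  obtain ⟨C, M, hC, hM, hPI⟩ := hPI
  refine ⟨max 1 (C * 4 ^ d / c), M, le_max_left _ _, hM, fun F hF hfin w x k hwx b hb hE => ?_⟩
  set R : ℝ := ((4 ^ (k + 1) : ℕ) : ℝ) with hR
  have hRe : R = 4 * 4 ^ k := by rw [hR]; push_cast; ring
  have h4k : (1 : ℝ) ≤ 4 ^ k := one_le_pow₀ (by norm_num)
  have hR1 : 1 ≤ R := by rw [hRe]; linarith
  -- The ratio `4` of the radii leaves room `3 * 4 ^ k` for moving the centre.
  have hsub : Metric.ball (vtx o w) ((4 ^ k : ℕ) : ℝ) ⊆ Metric.ball (vtx o x) R := by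
    apply Metric.ball_subset_ball'
    rw [dist_vtx, hRe]
    push_cast
    linarith
  have hmax : max (R ^ 2) (R ^ d) = R ^ d := by
    apply max_eq_right
    rw [← Real.rpow_natCast]
    exact Real.rpow_le_rpow_of_exponent_le hR1 (by exact_mod_cast hd)
  have hME : M * R = M * 4 ^ (k + 1) := by rw [hR]; push_cast; rfl
  have h1 := hPI (interp o F) (interp_mem_formDomain hgrowth hF hfin) (vtx o x) R (by linarith)
    (by rw [ediam_univ_eq_top (by linarith) hgrowth]; simp [ENNReal.top_div_of_ne_top])
  simp only [hmax, hME] at h1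
  have h2 := ofReal_sq_setAverage_sub_mul_le
    (cableMeasure_ball_ne_zero (o := o) hgrowth w (Nat.one_le_pow k 4 (by norm_num)))
    (cableMeasure_ball_lt_top hgrowth _ _).ne
    (integrableOn_interp_ball hgrowth hF (vtx o w) ((4 ^ k : ℕ) : ℝ)) (ballMean o F x (k + 1))
  -- The scale cancels here: the volume of the small ball is at least `c * (4 ^ k) ^ d`, against `R
  -- ^ d = 4 ^ d * (4 ^ k) ^ d` from the Poincaré inequality.
  have h3 : ENNReal.ofReal ((ballMean o F w k - ballMean o F x (k + 1)) ^ 2) *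
      ENNReal.ofReal (c * (4 ^ k) ^ d) ≤ ENNReal.ofReal (C * R ^ d) * ENNReal.ofReal b := by
    calc _ ≤ ENNReal.ofReal ((ballMean o F w k - ballMean o F x (k + 1)) ^ 2) *
          cableMeasure o (Metric.ball (vtx o w) ((4 ^ k : ℕ) : ℝ)) := by
          gcongr
          refine le_trans (le_of_eq ?_) (hvol w (4 ^ k) (Nat.one_le_pow k 4 (by norm_num)))
          push_cast
          rfl
      _ ≤ _ := h2
      _ ≤ _ := lintegral_mono_set hsub
      _ ≤ _ := h1
      _ ≤ _ := by gcongr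
  rw [← ENNReal.ofReal_mul (sq_nonneg _), ← ENNReal.ofReal_mul (by positivity),
    ENNReal.ofReal_le_ofReal_iff (by positivity), hRe,
    Real.mul_rpow (by norm_num) (by positivity)] at h3
  have hP : (0 : ℝ) < (4 ^ k : ℝ) ^ d := by positivity
  have h4 : (ballMean o F w k - ballMean o F x (k + 1)) ^ 2 ≤ C * 4 ^ d / c * b := by
    rw [div_mul_eq_mul_div, le_div_iff₀ hc]
    refine le_of_mul_le_mul_right ?_ hP
    linarith
  exact h4.trans (by gcongr; exact le_max_right _ _)

/-- The extension of the indicator of `v` is `1`-Lipschitz, equals `1` at `v`, and vanishes on edges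
that do not meet `v`. -/
theorem mem_edge_of_dist_vtx_lt_one [Fact G.Connected] [Nontrivial V] {v : V} {e : G.edgeSet}
    {s : unitInterval} (h : dist (proj o e s) (vtx o v) < 1) :
    v = o.src e ∨ v = o.tgt e := by
  classical
  by_contra! hne
  have h1 := abs_interp_sub_le (o := o) (F := Pi.single v 1) (fun a b _ => by
    simp only [Pi.single_apply]
    split_ifs <;> simp) (proj o e s) (vtx o v)
  rw [interp_vtx, interp_proj, Pi.single_eq_of_ne hne.1.symm, Pi.single_eq_of_ne hne.2.symm,
    Pi.single_eq_same] at h1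
  norm_num at h1
  linarith

/-- The start of the telescoping. The ball of radius `4 ^ 0 = 1` contains only points of edges at
`w`; there the extension differs from `F w` by at most one edge increment, and the whole edge lies
in the ball of radius `2`. -/
theorem sq_ballMean_zero_sub_le [Fact G.Connected] [Nontrivial V] {d : ℝ}
    (hgrowth : HasPolynomialGrowth G d) {F : V → ℝ} (hF : ∀ v, F v ∈ Icc (0 : ℝ) 1) (w : V)
    {b : ℝ} (hb : 0 ≤ b)
    (hE : energyOn o (interp o F) (Metric.ball (vtx o w) 2) ≤ ENNReal.ofReal b) :
    (ballMean o F w 0 - F w) ^ 2 ≤ b := by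
  have hμ0 := cableMeasure_ball_ne_zero (o := o) hgrowth w (Nat.one_le_pow 0 4 (by norm_num))
  have hμ1 := (cableMeasure_ball_lt_top hgrowth (vtx o w) ((4 ^ 0 : ℕ) : ℝ)).ne
  have h2 := ofReal_sq_setAverage_sub_mul_le hμ0 hμ1
    (integrableOn_interp_ball hgrowth hF (vtx o w) ((4 ^ 0 : ℕ) : ℝ)) (F w)
  have h3 : ∫⁻ p in Metric.ball (vtx o w) ((4 ^ 0 : ℕ) : ℝ),
      ENNReal.ofReal ((interp o F p - F w) ^ 2) ∂(cableMeasure o) ≤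
      ∫⁻ _ in Metric.ball (vtx o w) ((4 ^ 0 : ℕ) : ℝ), ENNReal.ofReal b ∂(cableMeasure o) := by
    refine setLIntegral_mono measurable_const fun p hp => ?_
    obtain ⟨e, s, rfl⟩ := exists_proj p
    rw [Metric.mem_ball] at hp
    have hw := mem_edge_of_dist_vtx_lt_one (by simpa using hp)
    refine le_trans ?_ ((le_energyOn_interp F Metric.isOpen_ball.measurableSet e fun t => ?_).trans
      hE)
    · apply ENNReal.ofReal_le_ofReal
      have hs0 := s.2.1
      have hs1 := s.2.2
      rcases hw with rfl | rfl
      · rw [interp_proj, show (1 - (s : ℝ)) * F (o.src e) + s * F (o.tgt e) - F (o.src e) =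
          s * (F (o.tgt e) - F (o.src e)) by ring, mul_pow]
        exact mul_le_of_le_one_left (sq_nonneg _) (pow_le_one₀ hs0 hs1)
      · rw [interp_proj, show (1 - (s : ℝ)) * F (o.src e) + s * F (o.tgt e) - F (o.tgt e) =
          -((1 - s) * (F (o.tgt e) - F (o.src e))) by ring, neg_sq, mul_pow]
        exact mul_le_of_le_one_left (sq_nonneg _) (pow_le_one₀ (by linarith) (by linarith))
    · rw [Metric.mem_ball, dist_comm]
      rcases hw with rfl | rfl
      · exact (dist_vtx_src_proj_le e t).trans_lt one_lt_two
      · exact (dist_vtx_tgt_proj_le e t).trans_lt one_lt_two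
  have h4 := h2.trans h3
  rw [setLIntegral_const] at h4
  exact (ENNReal.ofReal_le_ofReal_iff hb).1 ((ENNReal.mul_le_mul_iff_left hμ0 hμ1).1 h4)

end Averages

/-! ### Lower bound for the energy by telescoping and covering -/

section LowerBound

variable {V : Type*} {G : SimpleGraph V} {o : EdgeOrientation G}

theorem energyOn_mono [Fact G.Connected] (f : CableSystem o → ℝ) {A B : Set (CableSystem o)}
    (h : A ⊆ B) : energyOn o f A ≤ energyOn o f B :=
  lintegral_mono_set h

/-- If the energy near `w` is small at every scale, then `F w` is close to the mean of `F` over a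
large ball. -/
theorem abs_sub_ballMean_lt_half [Fact G.Connected] [Nontrivial V] {d : ℝ}
    (hgrowth : HasPolynomialGrowth G d) {C M : ℝ} (hC : 1 ≤ C) (hM : 1 ≤ M) {F : V → ℝ}
    (hF : ∀ v, F v ∈ Icc (0 : ℝ) 1)
    (hchain : ∀ (w x : V) (k : ℕ), (G.dist w x : ℝ) ≤ 3 * 4 ^ k → ∀ b : ℝ, 0 ≤ b →
      energyOn o (interp o F) (Metric.ball (vtx o x) (M * 4 ^ (k + 1))) ≤ ENNReal.ofReal b →
      (ballMean o F w k - ballMean o F x (k + 1)) ^ 2 ≤ C * b)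
    {w x : V} {K : ℕ} (hwx : (G.dist w x : ℝ) ≤ 3 * 4 ^ K)
    (hgood : ∀ k ≤ K, energyOn o (interp o F) (Metric.ball (vtx o w) (M * 4 ^ (k + 1))) ≤
      ENNReal.ofReal ((49 * C)⁻¹ * (4 ^ k / 4 ^ K)))
    (htot : energy o (interp o F) ≤ ENNReal.ofReal (49 * C)⁻¹) :
    |F w - ballMean o F x (K + 1)| < 1 / 2 := by
  have hC0 : 0 < C := by linarith
  -- With `49 = 7 ^ 2`, the right side is the square of `2 ^ k / (7 * 2 ^ K)`. These bounds form a
  -- geometric series with total at most `2 / 7`; the last change of centre costs `1 / 7`, and `3 /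
  -- 7 < 1 / 2`.
  have hstep : ∀ (a : ℝ) (k : ℕ), a ^ 2 ≤ C * ((49 * C)⁻¹ * (4 ^ k / 4 ^ K)) →
      |a| ≤ 2 ^ k / (7 * 2 ^ K) := by
    intro a k h
    refine abs_le_of_sq_le_sq (h.trans (le_of_eq ?_)) (by positivity)
    rw [div_pow, mul_pow, ← pow_mul, ← pow_mul, mul_comm k, mul_comm K, pow_mul, pow_mul]
    norm_num
    field_simp
  have h0 : |F w - ballMean o F w 0| ≤ 2 ^ 0 / (7 * 2 ^ K) := by
    rw [abs_sub_comm]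
    refine hstep _ 0 ?_
    refine (sq_ballMean_zero_sub_le hgrowth hF w (by positivity)
      ((energyOn_mono _ (Metric.ball_subset_ball ?_)).trans (hgood 0 (Nat.zero_le _)))).trans ?_
    · norm_num; linarith
    · exact le_mul_of_one_le_left (by positivity) hC
  have hk : ∀ k, k < K → |ballMean o F w k - ballMean o F w (k + 1)| ≤ 2 ^ k / (7 * 2 ^ K) := by
    intro k hk
    refine hstep _ k (hchain w w k ?_ _ (by positivity) (hgood k hk.le))
    rw [SimpleGraph.dist_self, Nat.cast_zero]
    positivity
  have hsum : ∀ k, k ≤ K → |F w - ballMean o F w k| ≤ 2 ^ (k + 1) / (7 * 2 ^ K) := by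
    intro k
    induction k with
    | zero =>
      intro _
      refine h0.trans ?_
      gcongr <;> norm_num
    | succ k ih =>
      intro hkK
      refine (abs_sub_le _ (ballMean o F w k) _).trans
        ((add_le_add (ih (by omega)) (hk k (by omega))).trans ?_)
      rw [← add_div]
      gcongr
      rw [pow_succ _ (k + 1), pow_succ]
      linarith [pow_pos (zero_lt_two (α := ℝ)) k]
  have hK := hsum K le_rfl
  -- The final step moves the centre from `w` to `x`, so that the mean no longer depends on `w`; the
  -- total energy suffices.
  have hlast : |ballMean o F w K - ballMean o F x (K + 1)| ≤ 2 ^ K / (7 * 2 ^ K) := by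
    refine hstep _ K (hchain w x K hwx _ (by positivity) ?_)
    refine (energyOn_mono _ (subset_univ _)).trans (htot.trans (le_of_eq ?_))
    rw [div_self (by positivity), mul_one]
  have h2K : (0 : ℝ) < 2 ^ K := by positivity
  rw [pow_succ, mul_comm (2 ^ K) (2 : ℝ), mul_div_mul_right _ _ h2K.ne'] at hK
  rw [show (2 : ℝ) ^ K / (7 * 2 ^ K) = 1 / 7 by field_simp] at hlast
  have := abs_sub_le (F w) (ballMean o F w K) (ballMean o F x (K + 1))
  linarith

theorem card_filter_abs_sub_le (s : Finset ℕ) (m : ℕ) {ρ : ℝ} (hρ : 0 ≤ ρ) :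
    (((s.filter fun n : ℕ => |(n : ℝ) - m| ≤ ρ).card : ℕ) : ℝ) ≤ 2 * ρ + 1 := by
  have hsub : (s.filter fun n : ℕ => |(n : ℝ) - m| ≤ ρ) ⊆
      Finset.Icc (m - ⌊ρ⌋₊) (m + ⌊ρ⌋₊) := by
    intro n hn
    have h := abs_le.1 (Finset.mem_filter.1 hn).2
    rw [Finset.mem_Icc, tsub_le_iff_right]
    constructor
    · have h1 : m ≤ ⌊(n : ℝ) + ρ⌋₊ := Nat.le_floor (by linarith)
      rwa [add_comm, Nat.floor_add_natCast hρ, add_comm] at h1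
    · have h1 : n ≤ ⌊(m : ℝ) + ρ⌋₊ := Nat.le_floor (by linarith)
      rwa [add_comm, Nat.floor_add_natCast hρ, add_comm] at h1
  have h1 := Finset.card_le_card hsub
  rw [Nat.card_Icc] at h1
  have h2 : (s.filter fun n : ℕ => |(n : ℝ) - m| ≤ ρ).card ≤ 2 * ⌊ρ⌋₊ + 1 := by omega
  have h3 : (((s.filter fun n : ℕ => |(n : ℝ) - m| ≤ ρ).card : ℕ) : ℝ) ≤ 2 * ⌊ρ⌋₊ + 1 := by
    exact_mod_cast h2
  linarith [Nat.floor_le hρ]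

/-- A covering argument: if around a vertex at every distance between `N` and `2 * N` there is a
ball with energy proportional to its radius, then the total energy is bounded below. -/
theorem le_energy_of_forall_exists_ball [hG : Fact G.Connected] [Nontrivial V] {M c : ℝ}
    (hM : 1 ≤ M) (hc : 0 < c) (f : CableSystem o → ℝ) (x : V) {N K : ℕ} (hN : 1 ≤ N)
    (hK : 4 ^ K ≤ 8 * N) (w : ℕ → V) (hw : ∀ m ∈ Finset.Icc N (2 * N), G.dist x (w m) = m)
    (k : ℕ → ℕ) (hk : ∀ m ∈ Finset.Icc N (2 * N), k m ≤ K)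
    (hE : ∀ m ∈ Finset.Icc N (2 * N), ENNReal.ofReal (c * (4 ^ k m / 4 ^ K)) ≤
      energyOn o f (Metric.ball (vtx o (w m)) (M * 4 ^ (k m + 1)))) :
    ENNReal.ofReal (c / (352 * M)) ≤ energy o f := by
  classical
  have hM0 : 0 < M := by linarith
  obtain ⟨u, hut, hdisj, hcov⟩ := Vitali.exists_disjoint_subfamily_covering_enlargement_ball
    (α := CableSystem o)
    (Finset.Icc N (2 * N) : Set ℕ) (fun m => vtx o (w m)) (fun m => M * 4 ^ (k m + 1))
    (M * 4 ^ (K + 1)) (fun m hm => by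
      have := hk m (Finset.mem_coe.1 hm)
      gcongr
      norm_num) 5 (by norm_num)
  have hufin : u.Finite := (Finset.finite_toSet _).subset hut
  set U := hufin.toFinset with hU
  have hUt : ∀ m ∈ U, m ∈ Finset.Icc N (2 * N) := fun m hm => hut (hufin.mem_toFinset.1 hm)
  -- The distance to `x` is `1`-Lipschitz and maps the enlarged balls to intervals that cover all
  -- integers from `N` to `2 * N`.
  have hclose : ∀ m ∈ Finset.Icc N (2 * N), ∃ b ∈ U,
      |(m : ℝ) - b| ≤ 5 * (M * 4 ^ (k b + 1)) := by
    intro m hm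
    obtain ⟨b, hb, hsub⟩ := hcov m hm
    refine ⟨b, hufin.mem_toFinset.2 hb, ?_⟩
    have hmem : vtx o (w m) ∈ Metric.ball (vtx o (w b)) (5 * (M * 4 ^ (k b + 1))) :=
      hsub (Metric.mem_ball_self (by positivity))
    rw [Metric.mem_ball] at hmem
    have h1 := abs_dist_sub_le (vtx o (w m)) (vtx o (w b)) (vtx o x)
    rw [dist_comm _ (vtx o x), dist_comm _ (vtx o x), dist_vtx, dist_vtx, hw m hm,
      hw b (hut hb)] at h1
    exact h1.trans hmem.le
  -- Each interval holds at most `2 * 5 * M * 4 ^ (k b + 1) + 1 ≤ 41 * M * 4 ^ k b` integers.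
  -- Combined with `4 ^ K ≤ 8 * N`, the constant `44` gives `352 = 8 * 44`.
  have hcount : (N : ℝ) ≤ 44 * M * ∑ b ∈ U, (4 : ℝ) ^ k b := by
    have hsub : Finset.Icc N (2 * N) ⊆ U.biUnion fun b =>
        (Finset.Icc N (2 * N)).filter fun n : ℕ => |(n : ℝ) - b| ≤ 5 * (M * 4 ^ (k b + 1)) := by
      intro m hm
      obtain ⟨b, hb, h⟩ := hclose m hm
      exact Finset.mem_biUnion.2 ⟨b, hb, Finset.mem_filter.2 ⟨hm, h⟩⟩
    have h1 := (Finset.card_le_card hsub).trans Finset.card_biUnion_le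
    rw [Nat.card_Icc] at h1
    have h2 : N ≤ ∑ b ∈ U, ((Finset.Icc N (2 * N)).filter fun n : ℕ =>
        |(n : ℝ) - b| ≤ 5 * (M * 4 ^ (k b + 1))).card := by omega
    have h3 : (N : ℝ) ≤ ∑ b ∈ U, (((Finset.Icc N (2 * N)).filter fun n : ℕ =>
        |(n : ℝ) - b| ≤ 5 * (M * 4 ^ (k b + 1))).card : ℝ) := by exact_mod_cast h2
    refine h3.trans ?_
    rw [Finset.mul_sum]
    refine Finset.sum_le_sum fun b _ => (card_filter_abs_sub_le _ b (by positivity)).trans ?_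
    have h4 : 1 ≤ M * 4 ^ k b := one_le_mul_of_one_le_of_one_le hM (one_le_pow₀ (by norm_num))
    rw [pow_succ]
    linarith
  have hsum : ENNReal.ofReal (∑ b ∈ U, c * (4 ^ k b / 4 ^ K)) ≤ energy o f := by
    rw [ENNReal.ofReal_sum_of_nonneg fun _ _ => by positivity]
    calc _ ≤ ∑ b ∈ U, energyOn o f (Metric.ball (vtx o (w b)) (M * 4 ^ (k b + 1))) :=
          Finset.sum_le_sum fun b hb => hE b (hUt b hb)
      _ = energyOn o f (⋃ b ∈ U, Metric.ball (vtx o (w b)) (M * 4 ^ (k b + 1))) := by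
          refine (lintegral_biUnion_finset ?_ (fun b _ => Metric.isOpen_ball.measurableSet) _).symm
          rw [hU, hufin.coe_toFinset]
          exact hdisj
      _ ≤ _ := energyOn_mono _ (subset_univ _)
  refine le_trans (ENNReal.ofReal_le_ofReal ?_) hsum
  rw [← Finset.mul_sum, ← Finset.sum_div, div_eq_mul_inv]
  gcongr
  have hK' : (4 : ℝ) ^ K ≤ 8 * N := by exact_mod_cast hK
  rw [inv_eq_one_div, div_le_div_iff₀ (by positivity) (by positivity), one_mul]
  linarith

/-- A function that takes both values `0` and `1` at every distance between `N` and `2 * N` from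
some vertex has energy bounded below. -/
theorem PoincareInequality.exists_le_vertexEnergy [hG : Fact G.Connected] [Nontrivial V] {d : ℝ}
    (hd : 2 ≤ d) (hgrowth : HasPolynomialGrowth G d)
    (hPI : PoincareInequality o (fun r => max (r ^ 2) (r ^ d))) :
    ∃ c : ℝ, 0 < c ∧ ∀ F : V → ℝ, (∀ v, F v ∈ Icc (0 : ℝ) 1) → F.support.Finite →
      ∀ (x : V) (N : ℕ), 1 ≤ N →
      (∀ m ∈ Finset.Icc N (2 * N), ∃ v, G.dist x v = m ∧ F v = 1) →
      (∀ m ∈ Finset.Icc N (2 * N), ∃ v, G.dist x v = m ∧ F v = 0) →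
      ENNReal.ofReal c ≤ vertexEnergy o F := by
  obtain ⟨C, M, hC, hM, h⟩ := hPI.exists_ballMean_sub_le hd hgrowth
  have hC0 : 0 < C := by linarith
  have hM0 : 0 < M := by linarith
  refine ⟨(49 * C)⁻¹ / (352 * M), by positivity, fun F hF hfin x N hN h1 h0 => ?_⟩
  rw [← energy_interp]
  by_contra! hlt
  have htot : energy o (interp o F) ≤ ENNReal.ofReal (49 * C)⁻¹ :=
    hlt.le.trans (ENNReal.ofReal_le_ofReal (div_le_self (by positivity) (by linarith)))
  set K := Nat.log 4 N + 1
  have hKN : N < 4 ^ K := Nat.lt_pow_succ_log_self (by norm_num) N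
  have hNK : 4 ^ K ≤ 8 * N := by
    have := Nat.pow_log_le_self 4 (show N ≠ 0 by omega)
    rw [pow_succ]
    omega
  -- If `η` were far from the mean, every vertex with value `η` at these distances would have a
  -- scale of large energy, and the covering argument would contradict `hlt`. Applied to `1` and
  -- `0`, this puts both within `1 / 2` of the same mean.
  have key : ∀ η : ℝ, (∀ m ∈ Finset.Icc N (2 * N), ∃ v, G.dist x v = m ∧ F v = η) →
      |η - ballMean o F x (K + 1)| < 1 / 2 := by
    intro η hη
    by_contra hnot
    have hbad : ∀ m : ℕ, ∃ v : V, ∃ k : ℕ, m ∈ Finset.Icc N (2 * N) → G.dist x v = m ∧ k ≤ K ∧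
        ENNReal.ofReal ((49 * C)⁻¹ * (4 ^ k / 4 ^ K)) ≤
          energyOn o (interp o F) (Metric.ball (vtx o v) (M * 4 ^ (k + 1))) := by
      intro m
      by_cases hm : m ∈ Finset.Icc N (2 * N)
      · obtain ⟨v, hv, rfl⟩ := hη m hm
        by_contra! hcon
        refine hnot (abs_sub_ballMean_lt_half hgrowth hC hM hF (h F hF hfin) ?_
          (fun k hk => ((hcon v k).2 hv hk).le) htot)
        rw [SimpleGraph.dist_comm, hv]
        have h2 : m ≤ 3 * 4 ^ K := by
          have := (Finset.mem_Icc.1 hm).2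
          omega
        exact_mod_cast h2
      · exact ⟨x, 0, fun h => absurd h hm⟩
    choose w k hwk using hbad
    exact hlt.not_ge (le_energy_of_forall_exists_ball hM (by positivity) _ x hN hNK w
      (fun m hm => (hwk m hm).1) k (fun m hm => (hwk m hm).2.1) fun m hm => (hwk m hm).2.2)
  have e1 := abs_lt.1 (key 1 h1)
  have e0 := abs_lt.1 (key 0 h0)
  linarith [e1.2, e0.1]

end LowerBound

/-! ### Connectivity of annuli -/

section Connectivity

variable {V : Type*} {G : SimpleGraph V} {o : EdgeOrientation G}

theorem exists_adj_dist_eq (hG : G.Connected) {x v : V} {m : ℕ} (h : G.dist x v = m + 1) :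
    ∃ u, G.Adj v u ∧ G.dist x u = m := by
  obtain ⟨p, hp⟩ := hG.exists_walk_length_eq_dist v x
  rw [SimpleGraph.dist_comm, h] at hp
  cases p with
  | nil => simp at hp
  | @cons _ u _ hadj p =>
    rw [SimpleGraph.Walk.length_cons] at hp
    refine ⟨u, hadj, le_antisymm ?_ ?_⟩
    · rw [SimpleGraph.dist_comm]
      exact (SimpleGraph.dist_le p).trans (by omega)
    · have h1 := hG.dist_triangle (u := x) (v := u) (w := v)
      rw [SimpleGraph.dist_eq_one_iff_adj.2 hadj.symm] at h1
      omega

/-- Following a geodesic towards `x` inside the positivity set of `h`. -/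
theorem exists_reflTransGen_posAdj_dist_eq (hG : G.Connected) {h : V → ℝ} {x v₀ : V} {m : ℕ}
    (hm : m ≤ G.dist x v₀) (hpos : ∀ v, m ≤ G.dist x v → G.dist x v ≤ G.dist x v₀ → 0 < h v) :
    ∃ v, G.dist x v = m ∧ Relation.ReflTransGen (PosAdj G h) v₀ v := by
  induction hm using Nat.decreasingInduction with
  | self => exact ⟨v₀, rfl, .refl⟩
  | of_succ k hk ih =>
    obtain ⟨v, hv, hreach⟩ := ih fun v h1 h2 => hpos v (by omega) h2
    obtain ⟨u, hadj, hu⟩ := exists_adj_dist_eq hG hv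
    exact ⟨u, hu, hreach.tail ⟨hadj, hpos v (by omega) (by omega), hpos u (by omega) (by omega)⟩⟩

instance instSymmPosAdj (h : V → ℝ) : Std.Symm (PosAdj G h) :=
  ⟨fun _ _ huv => ⟨huv.1.symm, huv.2.2, huv.2.1⟩⟩

/-- Annular quasi-convexity on the level of vertices. -/
theorem exists_chain_in_annulus [hG : Fact G.Connected] [Nontrivial V] {d : ℝ}
    (hd : 2 ≤ d) (hgrowth : HasPolynomialGrowth G d) (hcap : CapacityUpperBound o)
    (hPI : PoincareInequality o (fun r => max (r ^ 2) (r ^ d))) :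
    ∃ L : ℝ, 1 ≤ L ∧ ∀ (x : V) (N : ℕ), L ≤ N → ∀ t : ℝ, N ≤ t → ∀ y z : V,
      2 * N ≤ G.dist x y → (G.dist x y : ℝ) < t → 2 * N ≤ G.dist x z → (G.dist x z : ℝ) < t →
      Relation.ReflTransGen (fun u v => G.Adj u v ∧ (N : ℝ) / L ≤ G.dist x u ∧
        (G.dist x u : ℝ) < t * L) y z := by
  obtain ⟨c, hc, hlow⟩ := hPI.exists_le_vertexEnergy hd hgrowth
  obtain ⟨C, M, hC, hM, hcut⟩ := hcap.exists_cutoff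
  -- The number of scales is chosen so that the annular cutoff has energy at most `4 * C / n < c`.
  obtain ⟨n, hn⟩ := exists_nat_gt (4 * C / c)
  have hn0 : (0 : ℝ) < n := lt_of_le_of_lt (by positivity) hn
  have hL : 1 ≤ (2 * M) ^ n := one_le_pow₀ (by linarith)
  refine ⟨(2 * M) ^ n, hL, fun x N hN t ht y z hy1 hy2 hz1 hz2 => ?_⟩
  set L := (2 * M) ^ n with hLdef
  have hL0 : 0 < L := by linarith
  have hN1 : 1 ≤ N := by exact_mod_cast hL.trans hN
  have hNL : (N : ℝ) / L * L = N := div_mul_cancel₀ _ hL0.ne'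
  obtain ⟨h, h01, h1, hs0, ht0, hE⟩ := exists_annular_cutoff hG.out hM hcut
    (Nat.cast_pos.1 hn0) x (s := N / L) (t := t) ((one_le_div hL0).2 hN) (by rw [hNL]; exact ht)
  rw [hNL] at h1
  set U := {w | Relation.ReflTransGen (PosAdj G h) y w} with hU
  have hmem : z ∈ U := by
    by_contra hz
    -- The value `1` at distance `m` is found on a geodesic from `y`, inside `U`. The value `0` is
    -- found on one from `z`, in a component of the positivity set other than `U`.
    refine (hlow (U.indicator h) (fun v => ?_) ?_ x N hN1 (fun m hm => ?_) fun m hm => ?_).not_gt ?_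
    · by_cases hv : v ∈ U
      · rw [indicator_of_mem hv]
        exact h01 v
      · rw [indicator_of_notMem hv]
        exact ⟨le_rfl, zero_le_one⟩
    · refine (hgrowth.finite_ball x (t * L)).subset fun v hv => ?_
      by_contra hge
      simp only [mem_ofPred_eq, not_lt] at hge
      exact hv (indicator_apply_eq_zero.2 fun _ => ht0 v hge)
    · rw [Finset.mem_Icc] at hm
      obtain ⟨v, hv, hreach⟩ := exists_reflTransGen_posAdj_dist_eq hG.out (h := h) (v₀ := y)
        (hm.2.trans hy1) fun v hv1 hv2 => by
          rw [h1 v (by exact_mod_cast hm.1.trans hv1)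
            (lt_of_le_of_lt (by exact_mod_cast hv2) hy2)]
          exact one_pos
      have hmN : (m : ℝ) ≤ G.dist x y := by exact_mod_cast hm.2.trans hy1
      refine ⟨v, hv, ?_⟩
      rw [indicator_of_mem (show v ∈ U from hreach), h1 v] <;> rw [hv]
      · exact_mod_cast hm.1
      · linarith
    · rw [Finset.mem_Icc] at hm
      obtain ⟨v, hv, hreach⟩ := exists_reflTransGen_posAdj_dist_eq hG.out (h := h) (v₀ := z)
        (hm.2.trans hz1) fun v hv1 hv2 => by
          rw [h1 v (by exact_mod_cast hm.1.trans hv1)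
            (lt_of_le_of_lt (by exact_mod_cast hv2) hz2)]
          exact one_pos
      refine ⟨v, hv, indicator_of_notMem (fun hvU => hz ?_) _⟩
      exact Relation.ReflTransGen.trans hvU
        (Relation.ReflTransGen.stdSymm.symm _ _ hreach)
    · refine ((vertexEnergy_mono fun u v huv =>
        abs_indicator_component_sub_le (fun v => (h01 v).1) y huv).trans hE).trans_lt ?_
      rw [← ENNReal.ofReal_ofNat 4, ← ENNReal.ofReal_mul (by norm_num),
        ENNReal.ofReal_lt_ofReal_iff hc, ← mul_div_assoc, div_lt_iff₀ hn0]
      rw [div_lt_iff₀ hc] at hn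
      linarith
  refine Relation.ReflTransGen.mono (r := PosAdj G h) ?_ _ _ hmem
  rintro u v huv
  refine ⟨huv.1, ?_, ?_⟩
  · by_contra! hlt
    exact huv.2.1.ne' (hs0 u hlt)
  · by_contra! hge
    exact huv.2.1.ne' (ht0 u hge)

theorem joinedIn_of_range_proj_subset [Fact G.Connected] {S : Set (CableSystem o)} {e : G.edgeSet}
    (h : range (proj o e) ⊆ S) (s t : unitInterval) : JoinedIn S (proj o e s) (proj o e t) :=
  have : PathConnectedSpace unitInterval := isPathConnected_iff_pathConnectedSpace.1
    ((convex_Icc (0 : ℝ) 1).isPathConnected ⟨0, unitInterval.zero_mem⟩)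
  ((isPathConnected_range (continuous_proj e)).joinedIn _ ⟨s, rfl⟩ _ ⟨t, rfl⟩).mono h

end Connectivity

end Cable

end

/-! ### From vertex chains to curves in the cable system -/

open Cable in
theorem proposition2p5 {V : Type*} (G : SimpleGraph V) [G.LocallyFinite] [Fact G.Connected]
    (d : ℝ) (hd : 2 ≤ d) (hgrowth : Cable.HasPolynomialGrowth G d)
    (o : Cable.EdgeOrientation G)
    (hcap : Cable.CapacityUpperBound o)
    (hPI : Cable.PoincareInequality o (fun r => max (r ^ 2) (r ^ d))) :
    Cable.AnnularQuasiConvexAtLargeScales (Cable.CableSystem o) := by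
  have hG : G.Connected := Fact.out
  have : Nontrivial V := hgrowth.nontrivial (by linarith) hG
  obtain ⟨L, hL, hchain⟩ := exists_chain_in_annulus hd hgrowth hcap hPI
  have hL0 : 0 < L := by linarith
  refine ⟨32 * L, 16 * L, by positivity, by positivity, fun x r hr y hy z hz => ?_⟩
  have hr32 : 32 ≤ r := by linarith
  set S := Metric.ball x (16 * L * r) \ Metric.ball x (r / (16 * L)) with hS
  obtain ⟨ex, sx, rfl⟩ := Cable.exists_proj x
  set x₀ := o.src ex
  have hx₀ : dist (proj o ex sx) (vtx o x₀) ≤ 1 := by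
    rw [dist_comm]
    exact dist_vtx_src_proj_le ex sx
  -- The `2` pays for replacing `x` by the vertex `x₀` and a point of an edge by an end of that
  -- edge.
  have hrL : r / (16 * L) + 2 ≤ r / (8 * L) := by
    have h1 : r / (8 * L) = r / (16 * L) + r / (16 * L) := by field_simp; norm_num
    have h2 : 2 ≤ r / (16 * L) := by
      rw [le_div_iff₀ (by positivity)]
      linarith
    linarith
  have hLr : r ≤ L * r := le_mul_of_one_le_left (by linarith) hL
  have hedge : ∀ (e : G.edgeSet) (v : V), v = o.src e ∨ v = o.tgt e →
      r / (8 * L) ≤ G.dist x₀ v → (G.dist x₀ v : ℝ) < 3 * r * L → range (proj o e) ⊆ S := by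
    rintro e v hv h1 h2 _ ⟨s, rfl⟩
    have hvp : dist (vtx o v) (proj o e s) ≤ 1 := by
      rcases hv with rfl | rfl
      · exact dist_vtx_src_proj_le e s
      · exact dist_vtx_tgt_proj_le e s
    rw [← dist_vtx (o := o)] at h1 h2
    have t1 := dist_triangle4 (proj o ex sx) (vtx o x₀) (vtx o v) (proj o e s)
    have t2 := dist_triangle4 (vtx o x₀) (proj o ex sx) (proj o e s) (vtx o v)
    rw [dist_comm (vtx o x₀) (proj o ex sx), dist_comm (proj o e s) (vtx o v)] at t2
    rw [hS, mem_sdiff, Metric.mem_ball, Metric.mem_ball, dist_comm (proj o e s), not_lt]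
    constructor <;> linarith
  have hend : ∀ p ∈ Metric.ball (proj o ex sx) (2 * r) \ Metric.ball (proj o ex sx) r,
      ∃ v, r - 2 ≤ G.dist x₀ v ∧ (G.dist x₀ v : ℝ) < 2 * r + 2 ∧ JoinedIn S p (vtx o v) := by
    intro p hp
    obtain ⟨e, s, rfl⟩ := Cable.exists_proj p
    rw [mem_sdiff, Metric.mem_ball, Metric.mem_ball, dist_comm (proj o e s), not_lt] at hp
    have hvp := dist_vtx_src_proj_le (o := o) e s
    have t1 := dist_triangle4 (proj o ex sx) (vtx o x₀) (vtx o (o.src e)) (proj o e s)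
    have t2 := dist_triangle4 (vtx o x₀) (proj o ex sx) (proj o e s) (vtx o (o.src e))
    rw [dist_comm (vtx o x₀) (proj o ex sx), dist_comm (proj o e s) (vtx o _)] at t2
    rw [dist_vtx] at t1 t2
    have h1 : r - 2 ≤ G.dist x₀ (o.src e) := by linarith
    have h2 : (G.dist x₀ (o.src e) : ℝ) < 2 * r + 2 := by linarith
    have h3 : r / (8 * L) ≤ r - 2 := by
      have : r / (8 * L) ≤ r / 8 := by
        gcongr
        linarith
      linarith
    refine ⟨o.src e, h1, h2, ?_⟩
    rw [vtx_src]
    exact joinedIn_of_range_proj_subset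
      (hedge e _ (Or.inl rfl) (h3.trans h1) (by linarith)) _ _
  obtain ⟨y₀, hy1, hy2, hyS⟩ := hend y hy
  obtain ⟨z₀, hz1, hz2, hzS⟩ := hend z hz
  have hN1 : (⌊r / 4⌋₊ : ℝ) ≤ r / 4 := Nat.floor_le (by linarith)
  have hN2 : r / 4 < ⌊r / 4⌋₊ + 1 := Nat.lt_floor_add_one _
  -- As `r ≥ 32 * L`, this yields `L ≤ N`, `2 * N ≤ r - 2` and `r ≤ 8 * N`.
  set N := ⌊r / 4⌋₊
  have hdist : ∀ v, r - 2 ≤ G.dist x₀ v → 2 * N ≤ G.dist x₀ v := fun v hv => by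
    have : (2 * N : ℝ) ≤ G.dist x₀ v := by linarith
    exact_mod_cast this
  have hreach := hchain x₀ N (by linarith) (2 * r + 2) (by linarith) y₀ z₀ (hdist _ hy1) hy2
    (hdist _ hz1) hz2
  have hNr : r / (8 * L) ≤ N / L := by
    rw [div_le_div_iff₀ (by positivity) hL0]
    have : r ≤ 8 * N := by linarith
    nlinarith
  have hjoin : JoinedIn S (vtx o y₀) (vtx o z₀) := by
    clear hz1 hz2 hzS
    induction hreach with
    | refl => exact JoinedIn.refl hyS.target_mem
    | @tail u v _ huv ih =>
      -- The chain controls only the first vertex of each step, which is enough: `hedge` needs just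
      -- one end of the edge in the annulus.
      obtain ⟨hadj, hu1, hu2⟩ := huv
      have hu3 : (G.dist x₀ u : ℝ) < 3 * r * L := hu2.trans_le (by nlinarith)
      refine ih.trans ?_
      obtain ⟨e, ⟨rfl, rfl⟩ | ⟨rfl, rfl⟩⟩ := o.exists_edge hadj
      · rw [vtx_src, vtx_tgt]
        exact joinedIn_of_range_proj_subset
          (hedge e _ (Or.inl rfl) (hNr.trans hu1) hu3) _ _
      · rw [vtx_src, vtx_tgt]
        exact joinedIn_of_range_proj_subset
          (hedge e _ (Or.inr rfl) (hNr.trans hu1) hu3) _ _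
  exact (hyS.trans hjoin).trans hzS.symm
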